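/- In the Robertson–Webb (RW) model, the cake is $[0,1]$ and each of $n$ players $i$ has a private valuation $V_i(S)=\int_S v_i(x)\,dx$ given by a nonnegative integrable density $v_i$ on $[0,1]$ with $V_i([0,1])=1$. A deterministic RW protocol adaptively asks queries of two types: $\mathrm{Cut}_i(\alpha)$ with $\alpha\in[0,1]$, answered by the leftmost $y\in[0,1]$ with $V_i([0,y])=\alpha$, which then becomes a cut point; and $\mathrm{Eval}_i(y)$, answered by $V_i([0,y])$, where $y$ is a previously made cut point or an endpoint of the cake. It finally outputs an allocation whose pieces are demarcated by such points. A connected allocation $A=(A_1,\dots,A_n)$ is a partition of $[0,1]$ into $n$ (possibly empty) intervals, player $i$ receiving $A_i$; it is $\epsilon$-envy-free if $V_i(A_i)\ge V_i(A_j)-\epsilon$ for all $i,j$. **Theorem.** Computing a connected $\epsilon$-envy-free allocation for $n\ge 3$ players requires $\Omega(\log\frac1\epsilon)$ RW queries. That is, there are absolute constants $c>0$ and $\epsilon_0>0$ such that for every $n\ge3$, every $0<\epsilon<\epsilon_0$, and every deterministic RW protocol that on every instance $(V_1,\dots,V_n)$ stops and outputs a connected $\epsilon$-envy-free allocation, there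 is an instance on which the protocol asks at least $c\log\frac1\epsilon$ queries. -/

import Mathlib

open Set MeasureTheory

noncomputable section

/-- A valuation of the cake `[0,1]`: a nonnegative integrable value density of total mass one. -/
structure CakeValuation where
  density : ℝ → ℝ
  nonneg : ∀ x ∈ Icc (0 : ℝ) 1, 0 ≤ density x
  integrable : IntegrableOn density (Icc 0 1)
  normalized : ∫ x in Icc (0 : ℝ) 1, density x = 1

/-- The value `V(S)` of a piece `S ⊆ [0,1]`. -/
def CakeValuation.value (v : CakeValuation) (S : Set ℝ) : ℝ := ∫ x in S, v.density x

/-- The answer to a cut query: the leftmost point `y` of the cake with `V([0,y]) = α`. -/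
def CakeValuation.cutPoint (v : CakeValuation) (α : Icc (0 : ℝ) 1) : ℝ :=
  sInf {y | y ∈ Icc (0 : ℝ) 1 ∧ v.value (Icc 0 y) = α}

/-- The answer to a cut query always exists. -/
theorem CakeValuation.isLeast_cutPoint (v : CakeValuation) (α : Icc (0 : ℝ) 1) :
    IsLeast {y | y ∈ Icc (0 : ℝ) 1 ∧ v.value (Icc 0 y) = α} (v.cutPoint α) := by
  have hc : ContinuousOn (fun y => v.value (Icc 0 y)) (Icc 0 1) :=
    intervalIntegral.continuousOn_primitive_Icc v.integrable
  have h0 : v.value (Icc 0 0) = 0 := by simp [CakeValuation.value]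
  have h1 : v.value (Icc 0 1) = 1 := v.normalized
  have hne : {y | y ∈ Icc (0 : ℝ) 1 ∧ v.value (Icc 0 y) = α}.Nonempty := by
    have hα : (α : ℝ) ∈ Icc (v.value (Icc 0 0)) (v.value (Icc 0 1)) := by
      rw [h0, h1]; exact α.2
    obtain ⟨y, hy, hyα⟩ := intermediate_value_Icc zero_le_one hc hα
    exact ⟨y, hy, hyα⟩
  have hcl : IsClosed {y | y ∈ Icc (0 : ℝ) 1 ∧ v.value (Icc 0 y) = α} :=
    hc.preimage_isClosed_of_isClosed isClosed_Icc isClosed_singleton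
  exact hcl.isLeast_csInf hne ⟨0, fun y hy => hy.1.1⟩

/-- A connected allocation: a partition of `[0,1]` into `n` (possibly empty) intervals, where
player `i` receives `A i`. -/
structure IsConnectedAllocation {n : ℕ} (A : Fin n → Set ℝ) : Prop where
  interval : ∀ i, (A i).OrdConnected
  disjoint : ∀ i j, i ≠ j → Disjoint (A i) (A j)
  cover : (⋃ i, A i) = Icc 0 1

/-- No player values the piece of another player more than `ε` above their own piece. -/
def IsEnvyFreeUpTo {n : ℕ} (V : Fin n → CakeValuation) (ε : ℝ) (A : Fin n → Set ℝ) : Prop :=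
  ∀ i j, (V i).value (A j) - ε ≤ (V i).value (A i)

/-- The next move of a protocol: a cut query or an evaluate query addressed to player `i`, or
stopping with an assignment of pieces to the players. -/
inductive RWMove (n : ℕ) where
  | cut (i : Fin n) (α : Icc (0 : ℝ) 1)
  | eval (i : Fin n) (y : ℝ)
  | output (A : Fin n → Set ℝ)

/-- A deterministic protocol chooses its next move as an arbitrary function of the answers
received so far (in chronological order). -/
def RWProtocol (n : ℕ) := List ℝ → RWMove n

/-- `P.Reaches V h C`: running `P` on the instance `V`, the protocol reaches the point where it has
received the list of answers `h`, and `C` is the set of available cut points, namely the endpoints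
`0`, `1` of the cake and the answers to the cut queries. Evaluate queries may be asked only at
available cut points. -/
inductive RWProtocol.Reaches {n : ℕ} (P : RWProtocol n) (V : Fin n → CakeValuation) :
    List ℝ → Set ℝ → Prop where
  | start : P.Reaches V [] {0, 1}
  | cut {h : List ℝ} {C : Set ℝ} {i : Fin n} {α : Icc (0 : ℝ) 1} :
      P.Reaches V h C → P h = RWMove.cut i α →
      P.Reaches V (h ++ [(V i).cutPoint α]) (insert ((V i).cutPoint α) C)
  | eval {h : List ℝ} {C : Set ℝ} {i : Fin n} {y : ℝ} :
      P.Reaches V h C → P h = RWMove.eval i y → y ∈ C →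
      P.Reaches V (h ++ [(V i).value (Icc 0 y)]) C

/-- On the instance `V`, the protocol `P` stops after exactly `q` queries with output `A`, and the
pieces of `A` are demarcated by available cut points. -/
def RWProtocol.Outputs {n : ℕ} (P : RWProtocol n) (V : Fin n → CakeValuation) (q : ℕ)
    (A : Fin n → Set ℝ) : Prop :=
  ∃ h C, P.Reaches V h C ∧ h.length = q ∧ P h = RWMove.output A ∧ ∀ i, frontier (A i) ⊆ C

/-- On every instance, `P` stops with a connected `ε`-envy-free allocation. -/
def RWProtocol.ComputesConnectedEnvyFree {n : ℕ} (P : RWProtocol n) (ε : ℝ) : Prop :=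
  ∀ V : Fin n → CakeValuation, ∃ q A,
    P.Outputs V q A ∧ IsConnectedAllocation A ∧ IsEnvyFreeUpTo V ε A

end

/-! Two bounds are combined. If `n` exceeds `log (1/ε) / 20`, it suffices that every player must be
queried: an unqueried player's value can be moved entirely into someone else's piece. Otherwise an
adversary wins.

The adversary's valuations are nearly uniform, with a small bonus on pieces `i` and `nextPiece n i`
for player `i`. Approximate envy-freeness then forces the cuts near the multiples of `1/n` and gives
everybody a liked piece (`perm_liked`). Since `nextPiece` is one `n`-cycle, all players hold piece
`i` or all hold `nextPiece n i` (`perm_eq_or_eq_nextPiece`), so the `n` comparisons of the two liked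
pieces all point the same way. Around the cycle these comparisons force the first two cuts close to
`1/n` and `2/n` (`cuts_contradiction`): cuts outside tiny windows around these points leave envy.

It remains to keep cut points out of the windows, which shrink by the factor 17 at each level. Each
active player's distribution function deviates from the uniform one by nested plateaus, with one
hidden sign per level. Flipping the sign of level `m` moves the values taken on a window of level `m
+ 1` by at least the length of their range, so for any queried value one of the two signs puts the
answer outside (`exists_sign`). Points outside the windows of level `m` reveal only the first `m`
signs. The coefficients of the deviation make its central value cancel in every comparison, so the
choice of signs does not spoil the balance. Hence a query costs one level, and `M` queries are
needed as long as `100 n² ε` is at most the width of level `M`, which is `17 ^ (-M)` up to a factor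
polynomial in `n`. -/

noncomputable section

/-! ### Values of intervals, and valuations with a given distribution function -/

/-- The value of an initial segment is an interval integral. -/
theorem CakeValuation.value_Icc_zero (v : CakeValuation) {y : ℝ} (hy : 0 ≤ y) :
    v.value (Icc 0 y) = ∫ x in (0 : ℝ)..y, v.density x := by
  rw [CakeValuation.value, integral_Icc_eq_integral_Ioc, intervalIntegral.integral_of_le hy]

theorem CakeValuation.intervalIntegrable (v : CakeValuation) {a b : ℝ} (ha : a ∈ Icc (0 : ℝ) 1)
    (hb : b ∈ Icc (0 : ℝ) 1) : IntervalIntegrable v.density volume a b := by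
  rw [intervalIntegrable_iff]
  refine v.integrable.mono_set (uIoc_subset_uIcc.trans ?_)
  exact uIcc_subset_Icc ha hb

theorem Set.OrdConnected.ae_eq_Ioc {A : Set ℝ} (hA : A.OrdConnected) (hne : A.Nonempty)
    (hb : BddBelow A) (ha : BddAbove A) : A =ᵐ[volume] Ioc (sInf A) (sSup A) := by
  have h1 : Ioo (sInf A) (sSup A) ⊆ A :=
    IsConnected.Ioo_csInf_csSup_subset ⟨hne, hA.isPreconnected⟩ hb ha
  have h2 : A ⊆ Icc (sInf A) (sSup A) := fun x hx => ⟨csInf_le hb hx, le_csSup ha hx⟩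
  have h3 : A ≤ᵐ[volume] Ioc (sInf A) (sSup A) :=
    h2.eventuallyLE.trans Ioc_ae_eq_Icc.symm.le
  have h4 : Ioc (sInf A) (sSup A) ≤ᵐ[volume] A :=
    Ioo_ae_eq_Ioc.symm.le.trans h1.eventuallyLE
  exact h3.antisymm h4

/-- The value of an interval is the difference of the values of the initial segments. -/
theorem CakeValuation.value_eq_sub (v : CakeValuation) {A : Set ℝ} (hA : A.OrdConnected)
    (hne : A.Nonempty) (hsub : A ⊆ Icc 0 1) :
    v.value A = v.value (Icc 0 (sSup A)) - v.value (Icc 0 (sInf A)) := by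
  have hb : BddBelow A := bddBelow_Icc.mono hsub
  have ha : BddAbove A := bddAbove_Icc.mono hsub
  obtain ⟨x, hx⟩ := hne
  have hI : sInf A ∈ Icc (0 : ℝ) 1 :=
    ⟨le_csInf ⟨x, hx⟩ fun z hz => (hsub hz).1, (csInf_le hb hx).trans (hsub hx).2⟩
  have hS : sSup A ∈ Icc (0 : ℝ) 1 :=
    ⟨(hsub hx).1.trans (le_csSup ha hx), csSup_le ⟨x, hx⟩ fun z hz => (hsub hz).2⟩
  have hle : sInf A ≤ sSup A := (csInf_le hb hx).trans (le_csSup ha hx)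
  have h0 : (0 : ℝ) ∈ Icc (0 : ℝ) 1 := ⟨le_rfl, zero_le_one⟩
  rw [v.value_Icc_zero hI.1, v.value_Icc_zero hS.1,
    intervalIntegral.integral_interval_sub_left (v.intervalIntegrable h0 hS)
      (v.intervalIntegrable h0 hI), intervalIntegral.integral_of_le hle, CakeValuation.value]
  exact setIntegral_congr_set (hA.ae_eq_Ioc ⟨x, hx⟩ hb ha)

theorem CakeValuation.value_empty (v : CakeValuation) : v.value ∅ = 0 := by
  simp [CakeValuation.value]

/-- The valuation whose cumulative distribution function is the given monotone Lipschitz one. -/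
def CakeValuation.ofCDF (G : ℝ → ℝ) (hm : Monotone G) {K : NNReal} (hl : LipschitzWith K G)
    (h0 : G 0 = 0) (h1 : G 1 = 1) : CakeValuation where
  density := deriv G
  nonneg := fun _ _ => hm.deriv_nonneg
  integrable := by
    have := ((hl.lipschitzOnWith (s := uIcc 0 1)).absolutelyContinuousOnInterval
      ).intervalIntegrable_deriv
    rwa [intervalIntegrable_iff_integrableOn_Icc_of_le zero_le_one] at this
  normalized := by
    have := ((hl.lipschitzOnWith (s := uIcc 0 1)).absolutelyContinuousOnInterval
      ).integral_deriv_eq_sub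
    rw [intervalIntegral.integral_of_le zero_le_one] at this
    rw [integral_Icc_eq_integral_Ioc, this, h0, h1, sub_zero]

theorem CakeValuation.ofCDF_value (G : ℝ → ℝ) (hm : Monotone G) {K : NNReal}
    (hl : LipschitzWith K G) (h0 : G 0 = 0) (h1 : G 1 = 1) {y : ℝ} (hy : 0 ≤ y) :
    (CakeValuation.ofCDF G hm hl h0 h1).value (Icc 0 y) = G y := by
  have := ((hl.lipschitzOnWith (s := uIcc 0 y)).absolutelyContinuousOnInterval
    ).integral_deriv_eq_sub
  rw [CakeValuation.value_Icc_zero _ hy]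
  simp only [CakeValuation.ofCDF]
  rw [this, h0, sub_zero]

/-! ### Determinism of runs -/

namespace RWProtocol

variable {n : ℕ} {P : RWProtocol n} {V : Fin n → CakeValuation}

/-- The history after a given number of queries is unique. -/
theorem Reaches.unique {h : List ℝ} {C : Set ℝ} (hr : P.Reaches V h C) :
    ∀ {h' : List ℝ} {C' : Set ℝ}, P.Reaches V h' C' → h.length = h'.length → h = h' ∧ C = C' := by
  induction hr with
  | start =>
    intro h' C' hr' hl
    cases hr' with
    | start => exact ⟨rfl, rfl⟩
    | cut _ _ => simp at hl
    | eval _ _ _ => simp at hl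
  | cut hr hP ih =>
    intro h' C' hr' hl
    cases hr' with
    | start => simp at hl
    | cut hr' hP' =>
      obtain ⟨rfl, rfl⟩ := ih hr' (by simpa using hl)
      rw [hP] at hP'
      cases hP'
      exact ⟨rfl, rfl⟩
    | eval hr' hP' hy =>
      obtain ⟨rfl, rfl⟩ := ih hr' (by simpa using hl)
      rw [hP] at hP'
      cases hP'
  | eval hr hP hy ih =>
    intro h' C' hr' hl
    cases hr' with
    | start => simp at hl
    | cut hr' hP' =>
      obtain ⟨rfl, rfl⟩ := ih hr' (by simpa using hl)
      rw [hP] at hP'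
      cases hP'
    | eval hr' hP' hy' =>
      obtain ⟨rfl, rfl⟩ := ih hr' (by simpa using hl)
      rw [hP] at hP'
      cases hP'
      exact ⟨rfl, rfl⟩

/-- Every earlier point of a run is reached, and the protocol makes an admissible query there. -/
theorem Reaches.exists_earlier {h : List ℝ} {C : Set ℝ} (hr : P.Reaches V h C) :
    ∀ k < h.length, ∃ h' C', P.Reaches V h' C' ∧ h'.length = k ∧
      (∀ A, P h' ≠ RWMove.output A) ∧ ∀ i y, P h' = RWMove.eval i y → y ∈ C' := by
  induction hr with
  | start => intro k hk; simp at hk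
  | @cut h C i α hr hP ih =>
    intro k hk
    rcases Nat.lt_succ_iff_lt_or_eq.1 (by simpa using hk) with hk | rfl
    · exact ih k hk
    · exact ⟨h, C, hr, rfl, fun A => by simp [hP], fun i y => by simp [hP]⟩
  | @eval h C i y hr hP hy ih =>
    intro k hk
    rcases Nat.lt_succ_iff_lt_or_eq.1 (by simpa using hk) with hk | rfl
    · exact ih k hk
    · refine ⟨h, C, hr, rfl, fun A => by simp [hP], fun i' y' hP' => ?_⟩
      rw [hP] at hP'
      cases hP'
      exact hy

/-- A longer run would pass through the unique history of length `q`, where the protocol stops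
instead of asking. -/
theorem Reaches.length_le_of_outputs {h : List ℝ} {C : Set ℝ} (hr : P.Reaches V h C)
    {q : ℕ} {A : Fin n → Set ℝ} (ho : P.Outputs V q A) : h.length ≤ q := by
  by_contra hlt
  obtain ⟨h₀, C₀, hr₀, hl, hP, -⟩ := ho
  obtain ⟨h', C', hr', hl', hP', -⟩ := hr.exists_earlier q (not_le.1 hlt)
  obtain ⟨rfl, rfl⟩ := hr₀.unique hr' (hl.trans hl'.symm)
  exact hP' A hP

/-- The evaluate queries of a protocol that eventually stops are admissible. -/
theorem Reaches.eval_mem_of_outputs {h : List ℝ} {C : Set ℝ} (hr : P.Reaches V h C)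
    {i : Fin n} {y : ℝ} (hP : P h = RWMove.eval i y) {q : ℕ} {A : Fin n → Set ℝ}
    (ho : P.Outputs V q A) : y ∈ C := by
  have hle := hr.length_le_of_outputs ho
  obtain ⟨h₀, C₀, hr₀, rfl, hP₀, -⟩ := ho
  rcases hle.eq_or_lt with hl | hl
  · obtain ⟨rfl, rfl⟩ := hr.unique hr₀ hl
    rw [hP] at hP₀
    cases hP₀
  · obtain ⟨h', C', hr', hl', -, hy⟩ := hr₀.exists_earlier _ hl
    obtain ⟨rfl, rfl⟩ := hr.unique hr' hl'.symm
    exact hy i y hP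

/-- When a run stops, its output is the output of the protocol. -/
theorem Reaches.eq_of_outputs {h : List ℝ} {C : Set ℝ} (hr : P.Reaches V h C)
    {A' : Fin n → Set ℝ} (hP : P h = RWMove.output A') {q : ℕ} {A : Fin n → Set ℝ}
    (ho : P.Outputs V q A) : A = A' ∧ ∀ i, frontier (A i) ⊆ C := by
  have h1 := hr.length_le_of_outputs ho
  obtain ⟨h₀, C₀, hr₀, hl, hP₀, hf⟩ := ho
  have h2 : h₀.length ≤ h.length := by
    by_contra hlt
    obtain ⟨h', C', hr', hl', hP', -⟩ := hr₀.exists_earlier h.length (not_le.1 hlt)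
    obtain ⟨rfl, rfl⟩ := hr.unique hr' hl'.symm
    exact hP' A' hP
  obtain ⟨rfl, rfl⟩ := hr.unique hr₀ (by omega)
  rw [hP] at hP₀
  cases hP₀
  exact ⟨rfl, hf⟩

/-- A run depends only on the valuations of the players that are queried. -/
theorem Reaches.exists_queried {h : List ℝ} {C : Set ℝ} (hr : P.Reaches V h C) :
    ∃ Q : Finset (Fin n), Q.card ≤ h.length ∧
      ∀ V' : Fin n → CakeValuation, (∀ i ∈ Q, V' i = V i) → P.Reaches V' h C := by
  classical
  induction hr with
  | start => exact ⟨∅, by simp, fun _ _ => .start⟩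
  | @cut h C i α hr hP ih =>
    obtain ⟨Q, hQ, hQ'⟩ := ih
    refine ⟨insert i Q, (Finset.card_insert_le _ _).trans (by simpa using hQ), fun V' hV' => ?_⟩
    rw [← hV' i (Finset.mem_insert_self _ _)]
    exact .cut (hQ' V' fun j hj => hV' j (Finset.mem_insert_of_mem hj)) hP
  | @eval h C i y hr hP hy ih =>
    obtain ⟨Q, hQ, hQ'⟩ := ih
    refine ⟨insert i Q, (Finset.card_insert_le _ _).trans (by simpa using hQ), fun V' hV' => ?_⟩
    rw [← hV' i (Finset.mem_insert_self _ _)]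
    exact .eval (hQ' V' fun j hj => hV' j (Finset.mem_insert_of_mem hj)) hP hy

end RWProtocol

/-! ### Every player has to be queried -/

theorem CakeValuation.value_nonneg (v : CakeValuation) {S : Set ℝ} (hS : MeasurableSet S)
    (hsub : S ⊆ Icc 0 1) : 0 ≤ v.value S :=
  setIntegral_nonneg hS fun x hx => v.nonneg x (hsub hx)

namespace IsConnectedAllocation

variable {n : ℕ} {A : Fin n → Set ℝ}

theorem subset_Icc (hA : IsConnectedAllocation A) (i : Fin n) : A i ⊆ Icc 0 1 :=
  hA.cover ▸ subset_iUnion A i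

theorem value_nonneg (hA : IsConnectedAllocation A) (v : CakeValuation) (i : Fin n) :
    0 ≤ v.value (A i) :=
  v.value_nonneg (hA.interval i).measurableSet (hA.subset_Icc i)

/-- The values of the pieces add up to one. -/
theorem sum_value (hA : IsConnectedAllocation A) (v : CakeValuation) :
    ∑ i, v.value (A i) = 1 := by
  have := integral_iUnion_fintype (μ := volume) (f := v.density) (s := A)
    (fun i => (hA.interval i).measurableSet) (fun i j hij => hA.disjoint i j hij)
    (fun i => v.integrable.mono_set (hA.subset_Icc i))
  rw [hA.cover, v.normalized] at this
  exact this.symm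

end IsConnectedAllocation

/-- The uniform valuation of the interval `[a,b]`. -/
def CakeValuation.uniform (a b : ℝ) (ha : 0 ≤ a) (hab : a < b) (hb : b ≤ 1) : CakeValuation :=
  CakeValuation.ofCDF (fun y => max 0 (min 1 ((b - a)⁻¹ * (y - a))))
    (by
      have : 0 < (b - a)⁻¹ := inv_pos.2 (sub_pos.2 hab)
      intro x y hxy
      dsimp only
      gcongr)
    (K := ‖(b - a)⁻¹‖₊)
    (by
      have h : LipschitzWith ‖(b - a)⁻¹‖₊ fun y => (b - a)⁻¹ * (y - a) := by
        refine LipschitzWith.of_dist_le_mul fun x y => ?_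
        rw [Real.dist_eq, Real.dist_eq, ← mul_sub, abs_mul, sub_sub_sub_cancel_right]
        rfl
      exact (h.const_min 1).const_max 0)
    (by
      have : 0 < (b - a)⁻¹ := inv_pos.2 (sub_pos.2 hab)
      apply max_eq_left
      apply (min_le_right _ _).trans
      nlinarith)
    (by
      have h := sub_pos.2 hab
      have : 1 ≤ (b - a)⁻¹ * (1 - a) := by
        rw [inv_mul_eq_div, one_le_div h]; linarith
      rw [min_eq_left this]; norm_num)

theorem CakeValuation.uniform_value {a b : ℝ} (ha : 0 ≤ a) (hab : a < b) (hb : b ≤ 1) :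
    (CakeValuation.uniform a b ha hab hb).value (Icc 0 a) = 0 ∧
      (CakeValuation.uniform a b ha hab hb).value (Icc 0 b) = 1 := by
  have h := sub_pos.2 hab
  refine ⟨(CakeValuation.ofCDF_value _ _ _ _ _ ha).trans ?_,
    (CakeValuation.ofCDF_value _ _ _ _ _ (ha.trans hab.le)).trans ?_⟩
  · simp
  · rw [inv_mul_cancel₀ h.ne']
    simp

/-- A protocol that computes connected `ε`-envy-free allocations has to query every player. -/
theorem RWProtocol.ComputesConnectedEnvyFree.exists_le_outputs {n : ℕ} (hn : 2 ≤ n) {ε : ℝ}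
    (hε : ε < 1) {P : RWProtocol n} (hP : P.ComputesConnectedEnvyFree ε) :
    ∃ V q A, P.Outputs V q A ∧ n ≤ q := by
  classical
  let V₀ : Fin n → CakeValuation := fun _ =>
    CakeValuation.uniform 0 1 le_rfl zero_lt_one le_rfl
  obtain ⟨q, A, ho, hA, hef⟩ := hP V₀
  refine ⟨V₀, q, A, ho, ?_⟩
  by_contra hq
  obtain ⟨h, C, hr, hl, hout, -⟩ := id ho
  obtain ⟨Q, hQ, hQ'⟩ := hr.exists_queried
  obtain ⟨i, hi⟩ : ∃ i, i ∉ Q := by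
    by_contra hall
    push Not at hall
    have := Finset.card_eq_of_equiv_fin (s := Q) (n := n)
      ((Equiv.subtypeUnivEquiv hall))
    omega
  -- Player `i` is never queried, so changing that valuation changes neither the run nor its output.
  have hef' : ∀ v : CakeValuation, IsEnvyFreeUpTo (Function.update V₀ i v) ε A := by
    intro v
    obtain ⟨q', A', ho', -, hef'⟩ := hP (Function.update V₀ i v)
    have hr' := hQ' (Function.update V₀ i v) fun j hj => by
      rw [Function.update_of_ne]; rintro rfl; exact hi hj
    rw [← (hr'.eq_of_outputs hout ho').1]
    exact hef'
  -- Otherwise piece `i` has the whole uniform value, and any other player envies it by `1 > ε`.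
  have key : ∃ j, j ≠ i ∧ (A j).Nonempty ∧ sInf (A j) < sSup (A j) := by
    by_contra hno
    push Not at hno
    have hz : ∀ j, j ≠ i → (V₀ j).value (A j) = 0 := by
      intro j hj
      rcases (A j).eq_empty_or_nonempty with he | hne
      · rw [he, CakeValuation.value_empty]
      · have h1 := hno j hj hne
        have h2 : sInf (A j) ≤ sSup (A j) :=
          csInf_le_csSup hne (bddBelow_Icc.mono (hA.subset_Icc j))
            (bddAbove_Icc.mono (hA.subset_Icc j))
        rw [CakeValuation.value_eq_sub _ (hA.interval j) hne (hA.subset_Icc j),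
          le_antisymm h1 h2, sub_self]
    have hs : (V₀ i).value (A i) = 1 := by
      rw [← hA.sum_value (V₀ i), Finset.sum_eq_single i]
      · exact fun j _ hj => hz j hj
      · simp
    obtain ⟨j, hj⟩ : ∃ j : Fin n, j ≠ i :=
      have : Nontrivial (Fin n) := Fin.nontrivial_iff_two_le.2 hn
      exists_ne i
    have h1 := hef j i
    rw [hz j hj] at h1
    have h2 : (V₀ j).value (A i) = 1 := hs
    linarith
  obtain ⟨j, hj, hne, hlt⟩ := key
  have ha : 0 ≤ sInf (A j) := le_csInf hne fun x hx => (hA.subset_Icc j hx).1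
  have hb : sSup (A j) ≤ 1 := csSup_le hne fun x hx => (hA.subset_Icc j hx).2
  -- All of player `i`'s value is moved into the piece of `j`, which produces envy 1.
  set v := CakeValuation.uniform _ _ ha hlt hb with hv
  have h1 := hef' v i j
  rw [Function.update_self] at h1
  have h2 : v.value (A j) = 1 := by
    rw [v.value_eq_sub (hA.interval j) hne (hA.subset_Icc j), hv,
      (CakeValuation.uniform_value ha hlt hb).1, (CakeValuation.uniform_value ha hlt hb).2]
    norm_num
  have h3 : v.value (A i) + v.value (A j) ≤ 1 := by
    rw [← hA.sum_value v, ← Finset.sum_pair (f := fun k => v.value (A k)) hj.symm]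
    exact Finset.sum_le_sum_of_subset_of_nonneg (Finset.subset_univ _)
      fun k _ _ => hA.value_nonneg v k
  have h4 : v.value (A j) - ε ≤ v.value (A i) := h1
  linarith

/-! ### The cuts of a connected allocation -/

theorem csInf_mem_frontier {A : Set ℝ} (hne : A.Nonempty) (hb : BddBelow A) :
    sInf A ∈ frontier A := by
  refine ⟨csInf_mem_closure hne hb, fun hi => ?_⟩
  obtain ⟨x, hx, hxA⟩ := (Filter.eventually_mem_set.2 (mem_interior_iff_mem_nhds.1 hi)).exists_lt
  exact absurd (csInf_le hb hxA) (not_le.2 hx)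

/-- Disjoint intervals are ordered like any two of their points. -/
theorem Set.OrdConnected.lt_of_disjoint {A B : Set ℝ} (hA : A.OrdConnected) (hB : B.OrdConnected)
    (hd : Disjoint A B) {x y : ℝ} (hx : x ∈ A) (hy : y ∈ B) (hxy : x < y) :
    ∀ x' ∈ A, ∀ y' ∈ B, x' < y' := by
  intro x' hx' y' hy'
  by_contra hlt
  push Not at hlt
  rcases le_total x y' with h | h
  · exact disjoint_left.1 hd (hA.out hx hx' ⟨h, hlt⟩) hy'
  · exact disjoint_left.1 hd hx (hB.out hy' hy ⟨h, hxy.le⟩)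

/-- A connected allocation with nonempty pieces is given by the order of the pieces and the cuts
between them. -/
theorem IsConnectedAllocation.exists_cuts {n : ℕ} (hn : 0 < n) {A : Fin n → Set ℝ}
    (hA : IsConnectedAllocation A) (hne : ∀ i, (A i).Nonempty) :
    ∃ (e : Equiv.Perm (Fin n)) (t : ℕ → ℝ), t 0 = 0 ∧ t n = 1 ∧
      (∀ k, t k ∈ Icc (0 : ℝ) 1) ∧
      (∀ k : Fin n, t k ∈ frontier (A (e k))) ∧
      ∀ (v : CakeValuation) (k : Fin n),
        v.value (A (e k)) = v.value (Icc 0 (t (k + 1))) - v.value (Icc 0 (t k)) := by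
  have hb : ∀ i, BddBelow (A i) := fun i => bddBelow_Icc.mono (hA.subset_Icc i)
  have ha : ∀ i, BddAbove (A i) := fun i => bddAbove_Icc.mono (hA.subset_Icc i)
  choose x hx using hne
  have hl0 : ∀ i, 0 ≤ sInf (A i) := fun i =>
    le_csInf ⟨x i, hx i⟩ fun z hz => (hA.subset_Icc i hz).1
  have hr1 : ∀ i, sSup (A i) ≤ 1 := fun i =>
    csSup_le ⟨x i, hx i⟩ fun z hz => (hA.subset_Icc i hz).2
  have hlr : ∀ i, sInf (A i) ≤ sSup (A i) := fun i =>
    (csInf_le (hb i) (hx i)).trans (le_csSup (ha i) (hx i))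
  have hinj : Function.Injective x := fun i j hij => by
    by_contra hne
    exact disjoint_left.1 (hA.disjoint i j hne) (hx i) (hij ▸ hx j)
  -- Disjoint intervals are ordered like any chosen representatives, so sorting the points `x i`
  -- sorts the pieces.
  set e := Tuple.sort x with he
  have hmono : StrictMono (x ∘ e) :=
    (Tuple.monotone_sort x).strictMono_of_injective (hinj.comp e.injective)
  have hord : ∀ k k', k < k' → sSup (A (e k)) ≤ sInf (A (e k')) := by
    intro k k' hk
    have h := (hA.interval (e k)).lt_of_disjoint (hA.interval (e k'))
      (hA.disjoint _ _ (e.injective.ne hk.ne)) (hx _) (hx _) (hmono hk)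
    exact csSup_le ⟨_, hx _⟩ fun z hz => le_csInf ⟨_, hx _⟩ fun w hw => (h z hz w hw).le
  have hcov : ∀ z ∈ Icc (0 : ℝ) 1, ∃ k, z ∈ A (e k) := by
    intro z hz
    rw [← hA.cover] at hz
    obtain ⟨j, hj⟩ := mem_iUnion.1 hz
    exact ⟨e.symm j, by simpa using hj⟩
  -- Cuts are left endpoints; the default value 1 serves as the right end of the last piece.
  let t : ℕ → ℝ := fun k => if h : k < n then sInf (A (e ⟨k, h⟩)) else 1
  have ht : ∀ k : Fin n, t k = sInf (A (e k)) := fun k => by simp [t]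
  have ht1 : ∀ k : Fin n, t (k + 1) = sSup (A (e k)) := by
    intro k
    have hle : sSup (A (e k)) ≤ t (k + 1) := by
      by_cases h : (k : ℕ) + 1 < n
      · simp only [t, h, dif_pos]
        exact hord _ _ (Fin.lt_def.2 (Nat.lt_succ_self _))
      · simp only [t, h, dif_neg, not_false_eq_true]
        exact hr1 _
    -- A gap between consecutive pieces would contain an uncovered point of the cake.
    refine le_antisymm (not_lt.1 fun hlt => ?_) hle
    obtain ⟨z, hz1, hz2⟩ := exists_between hlt
    have ht1 : t (k + 1) ≤ 1 := by
      by_cases h : (k : ℕ) + 1 < n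
      · simp only [t, h, dif_pos]
        exact (hlr _).trans (hr1 _)
      · simp [t, h]
    obtain ⟨k', hk'⟩ := hcov z ⟨(hl0 _).trans ((hlr _).trans hz1.le), hz2.le.trans ht1⟩
    rcases lt_trichotomy k' k with h | rfl | h
    · have h1 := le_csSup (ha _) hk'
      have h2 := hord _ _ h
      have h3 := hlr (e k)
      linarith
    · exact absurd (le_csSup (ha _) hk') (not_le.2 hz1)
    · have h1 := csInf_le (hb _) hk'
      have hlt' : (k : ℕ) + 1 < n := lt_of_le_of_lt (Fin.lt_def.1 h) k'.2
      simp only [t, hlt', dif_pos] at hz2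
      rcases (Fin.le_def.2 (Fin.lt_def.1 h) : (⟨k + 1, hlt'⟩ : Fin n) ≤ k').eq_or_lt with h' | h'
      · rw [h'] at hz2
        linarith
      · have h2 := hord _ _ h'
        have h3 := hlr (e ⟨k + 1, hlt'⟩)
        linarith
  refine ⟨e, t, ?_, by simp [t], fun k => ?_, fun k => ?_, fun v k => ?_⟩
  · have h0 : t 0 = sInf (A (e ⟨0, hn⟩)) := ht ⟨0, hn⟩
    rw [h0]
    refine le_antisymm ?_ (hl0 _)
    obtain ⟨k, hk⟩ := hcov 0 ⟨le_rfl, zero_le_one⟩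
    have h1 := csInf_le (hb _) hk
    rcases (Fin.le_def.2 (Nat.zero_le _) : (⟨0, hn⟩ : Fin n) ≤ k).eq_or_lt with h' | h'
    · rwa [h']
    · exact (hlr _).trans ((hord _ _ h').trans h1)
  · by_cases h : k < n
    · simp only [t, h, dif_pos]
      exact ⟨hl0 _, (hlr _).trans (hr1 _)⟩
    · simp [t, h]
  · rw [ht]
    exact csInf_mem_frontier ⟨_, hx _⟩ (hb _)
  · rw [ht1, ht]
    exact v.value_eq_sub (hA.interval _) ⟨_, hx _⟩ (hA.subset_Icc _)

/-! ### Nested windows and the encoded deviation -/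

/-- The half-width of the window of level `k`. -/
def windowWidth (n k : ℕ) : ℝ := 1 / (6400 * (n : ℝ) ^ 3 * 17 ^ k)

theorem windowWidth_pos {n : ℕ} (hn : 3 ≤ n) (k : ℕ) : 0 < windowWidth n k := by
  have : (0 : ℝ) < n := by exact_mod_cast (by omega : 0 < n)
  unfold windowWidth
  positivity

/-- The ratio is 16 + 1: a plateau of slope 1/16 needs distance `16 * windowWidth n (k + 1)` to
climb to its height, and its flat top has half-width `windowWidth n (k + 1)`. -/
theorem windowWidth_succ (n k : ℕ) : windowWidth n k = 17 * windowWidth n (k + 1) := by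
  unfold windowWidth
  rcases Nat.eq_zero_or_pos n with rfl | h
  · simp
  · have : (0 : ℝ) < n := by exact_mod_cast h
    field_simp
    ring

theorem windowWidth_anti {n : ℕ} (hn : 3 ≤ n) : Antitone (windowWidth n) :=
  antitone_nat_of_succ_le fun k => by
    have := windowWidth_pos hn (k + 1)
    rw [windowWidth_succ n k]
    linarith

/-- A plateau of height `windowWidth n (k + 1)` on the window of level `k + 1`, vanishing outside
the window of level `k`. -/
def plateau (n k : ℕ) (u : ℝ) : ℝ :=
  max 0 (min (windowWidth n (k + 1)) ((windowWidth n k - |u|) / 16))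

theorem plateau_of_le_abs {n : ℕ} (hn : 3 ≤ n) {k : ℕ} {u : ℝ} (h : windowWidth n k ≤ |u|) :
    plateau n k u = 0 := by
  have := windowWidth_pos hn (k + 1)
  rw [plateau, min_eq_right (by linarith), max_eq_left (by linarith)]

theorem plateau_of_abs_le {n : ℕ} (hn : 3 ≤ n) {k : ℕ} {u : ℝ}
    (h : |u| ≤ windowWidth n (k + 1)) : plateau n k u = windowWidth n (k + 1) := by
  have := windowWidth_pos hn (k + 1)
  rw [plateau, min_eq_left (by rw [windowWidth_succ n k]; linarith), max_eq_right this.le]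

theorem abs_plateau_sub_le (n k : ℕ) (u v : ℝ) :
    |plateau n k u - plateau n k v| ≤ |(|u| - |v|)| / 16 := by
  unfold plateau
  refine (abs_max_sub_max_le_max _ _ _ _).trans ?_
  rw [sub_self, abs_zero, max_eq_right (abs_nonneg _)]
  refine (abs_min_sub_min_le_max _ _ _ _).trans ?_
  rw [sub_self, abs_zero, max_eq_right (abs_nonneg _), ← sub_div, abs_div, abs_sub_comm]
  rw [show windowWidth n k - |v| - (windowWidth n k - |u|) = |u| - |v| by ring]
  norm_num

/-- The deviation, within the windows around `0`, that is encoded by the sequence `e`. -/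
def wiggle (n M : ℕ) (e : ℕ → ℝ) (u : ℝ) : ℝ := ∑ k ∈ Finset.range M, e k * plateau n k u

theorem wiggle_abs (n M : ℕ) (e : ℕ → ℝ) (u : ℝ) : wiggle n M e |u| = wiggle n M e u := by
  simp [wiggle, plateau]

theorem wiggle_of_le_abs {n : ℕ} (hn : 3 ≤ n) (M : ℕ) (e : ℕ → ℝ) {u : ℝ}
    (h : windowWidth n 0 ≤ |u|) : wiggle n M e u = 0 :=
  Finset.sum_eq_zero fun k _ => by
    rw [plateau_of_le_abs hn ((windowWidth_anti hn (Nat.zero_le k)).trans h), mul_zero]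

theorem wiggle_congr {n : ℕ} (hn : 3 ≤ n) (M : ℕ) {e e' : ℕ → ℝ} {m : ℕ}
    (he : ∀ k < m, e k = e' k) {u : ℝ} (h : windowWidth n m ≤ |u|) :
    wiggle n M e u = wiggle n M e' u := by
  refine Finset.sum_congr rfl fun k _ => ?_
  rcases lt_or_ge k m with hk | hk
  · rw [he k hk]
  · rw [plateau_of_le_abs hn ((windowWidth_anti hn hk).trans h), mul_zero, mul_zero]

/-- On the edge of window `m + 1` the lower levels agree and the higher plateaus vanish, so only
level `m` contributes. For opposite signs the difference has size twice the half-width, exactly what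
the adversary needs. -/
theorem wiggle_sub_wiggle {n : ℕ} (hn : 3 ≤ n) {M : ℕ} {e e' : ℕ → ℝ} {m : ℕ} (hm : m < M)
    (he : ∀ k < m, e k = e' k) {u : ℝ} (h : |u| = windowWidth n (m + 1)) :
    wiggle n M e u - wiggle n M e' u = (e m - e' m) * windowWidth n (m + 1) := by
  unfold wiggle
  rw [← Finset.sum_sub_distrib, Finset.sum_eq_single m]
  · rw [plateau_of_abs_le hn h.le]
    ring
  · intro k _ hk
    rcases lt_or_gt_of_ne hk with hk | hk
    · rw [he k hk, sub_self]
    · rw [plateau_of_le_abs hn ((windowWidth_anti hn hk).trans h.ge), mul_zero, mul_zero, sub_self]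
  · intro h
    exact absurd (Finset.mem_range.2 hm) h

/-- Slopes do not accumulate: plateau `k` varies only for `|u|` between `windowWidth n (k + 1)` and
`windowWidth n k`, and these ranges do not overlap. The induction splits at `windowWidth n M`: the
new plateau vanishes beyond it, the old ones are constant before it. -/
theorem abs_wiggle_sub_le_of_le {n : ℕ} (hn : 3 ≤ n) {e : ℕ → ℝ} (he : ∀ k, |e k| ≤ 1)
    (M : ℕ) : ∀ {a b : ℝ}, 0 ≤ a → a ≤ b → |wiggle n M e b - wiggle n M e a| ≤ (b - a) / 16 := by
  induction M with
  | zero =>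
    intro a b _ hab
    simp only [wiggle, Finset.range_zero, Finset.sum_empty, sub_self, abs_zero]
    linarith
  | succ M ih =>
    have hs : ∀ u, wiggle n (M + 1) e u = wiggle n M e u + e M * plateau n M u := fun u =>
      Finset.sum_range_succ _ _
    have hout : ∀ {a b : ℝ}, windowWidth n M ≤ a → a ≤ b →
        |wiggle n (M + 1) e b - wiggle n (M + 1) e a| ≤ (b - a) / 16 := by
      intro a b ha hab
      have h0 := windowWidth_pos hn M
      rw [hs, hs, plateau_of_le_abs hn (ha.trans (le_abs_self a)),
        plateau_of_le_abs hn ((ha.trans hab).trans (le_abs_self b)), mul_zero, add_zero, add_zero]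
      exact ih (h0.le.trans ha) hab
    have hin : ∀ {a b : ℝ}, 0 ≤ a → a ≤ b → b ≤ windowWidth n M →
        |wiggle n (M + 1) e b - wiggle n (M + 1) e a| ≤ (b - a) / 16 := by
      intro a b ha hab hb
      have hc : wiggle n M e b = wiggle n M e a := by
        refine Finset.sum_congr rfl fun k hk => ?_
        have hk' : windowWidth n M ≤ windowWidth n (k + 1) :=
          windowWidth_anti hn (Finset.mem_range.1 hk)
        rw [plateau_of_abs_le hn, plateau_of_abs_le hn]
        · rw [abs_of_nonneg ha]; linarith
        · rw [abs_of_nonneg (ha.trans hab)]; linarith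
      rw [hs, hs, hc, add_sub_add_left_eq_sub, ← mul_sub, abs_mul]
      refine (mul_le_of_le_one_left (abs_nonneg _) (he M)).trans
        ((abs_plateau_sub_le n M b a).trans ?_)
      rw [abs_of_nonneg ha, abs_of_nonneg (ha.trans hab), abs_of_nonneg (sub_nonneg.2 hab)]
    intro a b ha hab
    rcases le_total (windowWidth n M) a with h1 | h1
    · exact hout h1 hab
    rcases le_total b (windowWidth n M) with h2 | h2
    · exact hin ha hab h2
    · have h3 := hout le_rfl h2
      have h4 := hin ha h1 le_rfl
      have h5 := abs_sub_le (wiggle n (M + 1) e b) (wiggle n (M + 1) e (windowWidth n M))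
        (wiggle n (M + 1) e a)
      linarith

/-- The deviation is Lipschitz with constant `1/16`. -/
theorem abs_wiggle_sub_le {n : ℕ} (hn : 3 ≤ n) {e : ℕ → ℝ} (he : ∀ k, |e k| ≤ 1) (M : ℕ)
    (a b : ℝ) : |wiggle n M e b - wiggle n M e a| ≤ |b - a| / 16 := by
  rw [← wiggle_abs n M e a, ← wiggle_abs n M e b]
  have h := abs_abs_sub_abs_le_abs_sub b a
  rcases le_total |a| |b| with hab | hab
  · refine (abs_wiggle_sub_le_of_le hn he M (abs_nonneg a) hab).trans ?_
    rw [abs_of_nonneg (sub_nonneg.2 hab)] at h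
    linarith
  · rw [abs_sub_comm]
    refine (abs_wiggle_sub_le_of_le hn he M (abs_nonneg b) hab).trans ?_
    rw [abs_of_nonpos (sub_nonpos.2 hab)] at h
    linarith

/-- The deviation varies by at most a sixteenth of the distance travelled inside the window. -/
theorem abs_wiggle_sub_zero_le {n : ℕ} (hn : 3 ≤ n) {e : ℕ → ℝ} (he : ∀ k, |e k| ≤ 1) (M : ℕ)
    (u : ℝ) : |wiggle n M e u - wiggle n M e 0| ≤ min |u| (windowWidth n 0) / 16 := by
  rcases le_total |u| (windowWidth n 0) with h | h
  · rw [min_eq_left h]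
    simpa using abs_wiggle_sub_le hn he M 0 u
  · rw [min_eq_right h]
    have h0 := (windowWidth_pos hn 0).le
    have h1 : wiggle n M e u = wiggle n M e (windowWidth n 0) := by
      rw [wiggle_of_le_abs hn M e h, wiggle_of_le_abs hn M e (le_abs_self _)]
    rw [h1]
    simpa [abs_of_nonneg h0] using abs_wiggle_sub_le hn he M 0 (windowWidth n 0)

theorem abs_wiggle_le {n : ℕ} (hn : 3 ≤ n) {e : ℕ → ℝ} (he : ∀ k, |e k| ≤ 1) (M : ℕ)
    (u : ℝ) : |wiggle n M e u| ≤ windowWidth n 0 / 16 := by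
  have h0 := (windowWidth_pos hn 0).le
  rcases le_total |u| (windowWidth n 0) with h | h
  · have h1 := abs_wiggle_sub_le_of_le hn he M (abs_nonneg u) h
    rw [wiggle_of_le_abs hn M e (le_abs_self _), wiggle_abs, zero_sub, abs_neg] at h1
    have := abs_nonneg u
    linarith
  · rw [wiggle_of_le_abs hn M e h, abs_zero]
    linarith

/-! ### Ramps and truncations -/

/-- A step from `0` to `1` between `1/4` and `3/4`. -/
def ramp (u : ℝ) : ℝ := max 0 (min 1 (2 * u - 1 / 2))

theorem ramp_of_le {u : ℝ} (h : u ≤ 1 / 4) : ramp u = 0 := by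
  rw [ramp, min_eq_right (by linarith), max_eq_left (by linarith)]

theorem ramp_of_ge {u : ℝ} (h : 3 / 4 ≤ u) : ramp u = 1 := by
  rw [ramp, min_eq_left (by linarith), max_eq_right (by norm_num)]

theorem ramp_nonneg (u : ℝ) : 0 ≤ ramp u := le_max_left _ _

theorem ramp_le_one (u : ℝ) : ramp u ≤ 1 := max_le zero_le_one (min_le_left _ _)

theorem ramp_mono : Monotone ramp := fun x y h => by
  unfold ramp
  gcongr

theorem ramp_sub_le {x y : ℝ} (h : x ≤ y) : ramp y - ramp x ≤ 2 * (y - x) := by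
  unfold ramp
  rcases max_cases 0 (min 1 (2 * y - 1 / 2)) with h1 | h1 <;>
    rcases max_cases 0 (min 1 (2 * x - 1 / 2)) with h2 | h2 <;>
    rcases min_cases 1 (2 * y - 1 / 2) with h3 | h3 <;>
    rcases min_cases 1 (2 * x - 1 / 2) with h4 | h4 <;> linarith

/-- The truncation to `[-w,w]`. -/
def clampTo (w u : ℝ) : ℝ := max (-w) (min w u)

theorem clampTo_of_abs_le {w u : ℝ} (h : |u| ≤ w) : clampTo w u = u := by
  have := abs_le.1 h
  rw [clampTo, min_eq_right this.2, max_eq_right this.1]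

theorem clampTo_of_ge {w u : ℝ} (hw : 0 ≤ w) (h : w ≤ u) : clampTo w u = w := by
  rw [clampTo, min_eq_left h, max_eq_right (by linarith)]

theorem clampTo_of_le {w u : ℝ} (hw : 0 ≤ w) (h : u ≤ -w) : clampTo w u = -w := by
  rw [clampTo, min_eq_right (by linarith), max_eq_left h]

theorem abs_clampTo_le {w : ℝ} (hw : 0 ≤ w) (u : ℝ) : |clampTo w u| ≤ w :=
  abs_le.2 ⟨le_max_left _ _, max_le (by linarith) (min_le_left _ _)⟩

theorem clampTo_mono (w : ℝ) : Monotone (clampTo w) := fun x y h => by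
  unfold clampTo
  gcongr

/-- Truncations to disjoint windows together grow at most as fast as the identity. -/
theorem clampTo_add_clampTo_le {w a b x y : ℝ} (hw : 0 ≤ w) (hab : a + w ≤ b - w) (h : x ≤ y) :
    clampTo w (y - a) + clampTo w (y - b) - (clampTo w (x - a) + clampTo w (x - b)) ≤ y - x := by
  unfold clampTo
  rcases max_cases (-w) (min w (y - a)) with h1 | h1 <;>
    rcases max_cases (-w) (min w (y - b)) with h2 | h2 <;>
    rcases max_cases (-w) (min w (x - a)) with h3 | h3 <;>
    rcases max_cases (-w) (min w (x - b)) with h4 | h4 <;>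
    rcases min_cases w (y - a) with h5 | h5 <;>
    rcases min_cases w (y - b) with h6 | h6 <;>
    rcases min_cases w (x - a) with h7 | h7 <;>
    rcases min_cases w (x - b) with h8 | h8 <;> linarith

/-! ### The hard valuations -/

/-- The piece that player `i` likes as much as piece `i`. -/
def nextPiece (n i : ℕ) : ℕ :=
  -- On the indices below `n` this is the single cycle 0, 1, n-1, n-2, ..., 3, 2, 0.
  if i = 0 then 1 else if i = 1 then n - 1 else if i = 2 then 0 else i - 1

/-- The extra value of the two liked pieces together. -/
def liking (n : ℕ) : ℝ := 1 / (32 * (n : ℝ) ^ 2)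

/-- The effect of the deviation on an active player at the first cut. -/
def leftCoef (n i : ℕ) : ℝ := if i = 1 ∧ n = 3 then 2 else 1

/-- The effect of the deviation on an active player at the second cut. -/
def rightCoef (i : ℕ) : ℝ := if i = 0 then 2 else if i = 1 then 1 else -1

/-- The cumulative distribution function of player `i` before the liked pieces get their extra
value: the active players `0,1,2` deviate from the uniform one as encoded by `e`, and the others
have no value in the windows around the first two cuts. -/
def baseCDF (n M : ℕ) (e : ℕ → ℝ) (i : ℕ) (y : ℝ) : ℝ :=
  if i < 3 then
    -- The coefficients balance the central deviation between piece `i` and piece `nextPiece n i`.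
    -- The net coefficient is 2·1 - 2 for player 0, 1 - 1 for player 1 (2·1 - 2 if `n = 3`), and
    -- -(-1) - 1 for player 2.
    y + leftCoef n i * wiggle n M e (y - 1 / n) + rightCoef i * wiggle n M e (y - 2 / n)
  else
    -- The truncations remove the value of both windows; the ramps return it, in shares `w`, `2w`,
    -- `w` with `w = windowWidth n 0`, to the middles of pieces 0, 1, 2. Multiples of `1/n` thus
    -- keep their uniform value, and the -2 makes the value at 0 vanish.
    y - (clampTo (windowWidth n 0) (y - 1 / n) + clampTo (windowWidth n 0) (y - 2 / n)) +
      windowWidth n 0 * (ramp (n * y) + 2 * ramp (n * y - 1) + ramp (n * y - 2) - 2)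

/-- The cumulative distribution function of player `i`. -/
def playerCDF (n M : ℕ) (e : ℕ → ℝ) (i : ℕ) (y : ℝ) : ℝ :=
  (1 - liking n) * baseCDF n M e i y +
    liking n / 2 * (ramp (n * y - i) + ramp (n * y - nextPiece n i))

section

variable {n : ℕ} (hn : 3 ≤ n)
include hn

theorem three_le_cast : (3 : ℝ) ≤ n := by exact_mod_cast hn

theorem liking_pos : 0 < liking n := by
  have := three_le_cast hn
  unfold liking
  positivity

theorem liking_mul_le : liking n * n ≤ 1 / 96 := by
  have := three_le_cast hn
  have h : (0 : ℝ) < n := by linarith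
  rw [liking, div_mul_eq_mul_div, div_le_iff₀ (by positivity)]
  nlinarith

theorem liking_le : liking n ≤ 1 / 288 := by
  have := three_le_cast hn
  have := liking_mul_le hn
  have := liking_pos hn
  nlinarith

theorem windowWidth_mul_le : windowWidth n 0 * n ≤ 1 / 57600 := by
  have := three_le_cast hn
  have h : (0 : ℝ) < n := by linarith
  have h2 : (9 : ℝ) ≤ (n : ℝ) ^ 2 := by nlinarith
  rw [windowWidth, div_mul_eq_mul_div, div_le_iff₀ (by positivity)]
  nlinarith

/-- The windows lie well inside the zones of radius 1/4 (in the scale `n * y`) around integers,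
where all ramps are constant. This separates the bonuses from the deviations. -/
theorem windowWidth_le_abs_sub {j y : ℝ} (h : 1 / 4 ≤ |n * y - j|) :
    windowWidth n 0 ≤ |y - j / n| := by
  have h3 := three_le_cast hn
  have hw := windowWidth_mul_le hn
  have h0 : (0 : ℝ) < n := by linarith
  have h1 : (n : ℝ) * y - j = n * (y - j / n) := by field_simp
  rw [h1, abs_mul, abs_of_pos h0] at h
  by_contra hlt
  nlinarith

theorem abs_mul_sub_le {j y : ℝ} (h : |y - j / n| ≤ windowWidth n 0) : |n * y - j| ≤ 1 / 4 := by
  have h3 := three_le_cast hn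
  have hw := windowWidth_mul_le hn
  have h0 : (0 : ℝ) < n := by linarith
  have h1 : (n : ℝ) * y - j = n * (y - j / n) := by field_simp
  rw [h1, abs_mul, abs_of_pos h0]
  nlinarith

omit hn in
theorem ramp_zone {k j : ℕ} {y : ℝ} (h : |n * y - k| ≤ 1 / 4) :
    ramp (n * y - j) = if j < k then 1 else 0 := by
  have := abs_le.1 h
  split_ifs with hjk
  · have : (j : ℝ) + 1 ≤ k := by exact_mod_cast hjk
    exact ramp_of_ge (by linarith)
  · have : (k : ℝ) ≤ j := by exact_mod_cast not_lt.1 hjk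
    exact ramp_of_le (by linarith)

theorem wiggle_far (M : ℕ) (e : ℕ → ℝ) {j k : ℕ} (hjk : j ≠ k) {y : ℝ}
    (h : |n * y - k| ≤ 1 / 4) : wiggle n M e (y - (j : ℝ) / n) = 0 := by
  refine wiggle_of_le_abs hn M e (windowWidth_le_abs_sub hn ?_)
  have := abs_le.1 h
  rcases lt_or_gt_of_ne hjk with hjk | hjk
  · have : (j : ℝ) + 1 ≤ k := by exact_mod_cast hjk
    exact le_abs.2 (.inl (by linarith))
  · have : (k : ℝ) + 1 ≤ j := by exact_mod_cast hjk
    exact le_abs.2 (.inr (by linarith))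

theorem baseCDF_active_one (M : ℕ) (e : ℕ → ℝ) {i : ℕ} (hi : i < 3) {y : ℝ}
    (h : |n * y - 1| ≤ 1 / 4) :
    baseCDF n M e i y = y + leftCoef n i * wiggle n M e (y - 1 / n) := by
  have h2 := wiggle_far hn M e (j := 2) (k := 1) (by norm_num) (y := y) (by simpa using h)
  rw [baseCDF, if_pos hi]
  push_cast at h2
  rw [h2, mul_zero, add_zero]

theorem baseCDF_active_two (M : ℕ) (e : ℕ → ℝ) {i : ℕ} (hi : i < 3) {y : ℝ}
    (h : |n * y - 2| ≤ 1 / 4) :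
    baseCDF n M e i y = y + rightCoef i * wiggle n M e (y - 2 / n) := by
  have h2 := wiggle_far hn M e (j := 1) (k := 2) (by norm_num) (y := y) (by simpa using h)
  rw [baseCDF, if_pos hi]
  push_cast at h2
  rw [h2, mul_zero, add_zero]

theorem clampTo_far {j : ℝ} {y : ℝ} (h : 1 / 4 ≤ |n * y - j|) :
    clampTo (windowWidth n 0) (y - j / n) =
      if j ≤ n * y then windowWidth n 0 else -windowWidth n 0 := by
  have h1 := windowWidth_le_abs_sub hn h
  have h0 : (0 : ℝ) < n := by linarith [three_le_cast hn]
  have h2 := (windowWidth_pos hn 0)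
  split_ifs with hj
  · have : 0 ≤ y - j / n := by
      rw [sub_nonneg, div_le_iff₀ h0]; linarith
    rw [abs_of_nonneg this] at h1
    exact clampTo_of_ge h2.le h1
  · have : y - j / n ≤ 0 := by
      rw [sub_nonpos, le_div_iff₀ h0]; linarith
    rw [abs_of_nonpos this] at h1
    exact clampTo_of_le h2.le (by linarith)

theorem baseCDF_dummy_one (M : ℕ) (e : ℕ → ℝ) {i : ℕ} (hi : ¬ i < 3) {y : ℝ}
    (h : |n * y - 1| ≤ 1 / 4) :
    baseCDF n M e i y = y - clampTo (windowWidth n 0) (y - 1 / n) := by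
  have h' := abs_le.1 h
  have h2 := clampTo_far hn (j := 2) (y := y) (le_abs.2 (.inr (by linarith)))
  rw [if_neg (by linarith)] at h2
  rw [baseCDF, if_neg hi, h2, ramp_of_ge (by linarith), ramp_of_le (by linarith),
    ramp_of_le (by linarith)]
  ring

theorem baseCDF_dummy_two (M : ℕ) (e : ℕ → ℝ) {i : ℕ} (hi : ¬ i < 3) {y : ℝ}
    (h : |n * y - 2| ≤ 1 / 4) :
    baseCDF n M e i y = y - clampTo (windowWidth n 0) (y - 2 / n) := by
  have h' := abs_le.1 h
  have h2 := clampTo_far hn (j := 1) (y := y) (le_abs.2 (.inl (by linarith)))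
  rw [if_pos (by linarith)] at h2
  rw [baseCDF, if_neg hi, h2, ramp_of_ge (by linarith), ramp_of_ge (by linarith),
    ramp_of_le (by linarith)]
  ring

theorem baseCDF_other (M : ℕ) (e : ℕ → ℝ) (i : ℕ) {k : ℕ} (h1 : k ≠ 1) (h2 : k ≠ 2) {y : ℝ}
    (h : |n * y - k| ≤ 1 / 4) : baseCDF n M e i y = y := by
  have h' := abs_le.1 h
  by_cases hi : i < 3
  · have h3 := wiggle_far hn M e h1.symm h
    have h4 := wiggle_far hn M e h2.symm h
    push_cast at h3 h4
    rw [baseCDF, if_pos hi, h3, h4]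
    ring
  · rw [baseCDF, if_neg hi]
    rcases Nat.eq_zero_or_pos k with rfl | hk
    · push_cast at h'
      have h3 := clampTo_far hn (j := 1) (y := y) (le_abs.2 (.inr (by linarith)))
      have h4 := clampTo_far hn (j := 2) (y := y) (le_abs.2 (.inr (by linarith)))
      rw [if_neg (by linarith)] at h3 h4
      rw [h3, h4, ramp_of_le (by linarith), ramp_of_le (by linarith), ramp_of_le (by linarith)]
      ring
    · have hk3 : (3 : ℝ) ≤ k := by exact_mod_cast (by omega : 3 ≤ k)
      have h3 := clampTo_far hn (j := 1) (y := y) (le_abs.2 (.inl (by linarith)))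
      have h4 := clampTo_far hn (j := 2) (y := y) (le_abs.2 (.inl (by linarith)))
      rw [if_pos (by linarith)] at h3 h4
      rw [h3, h4, ramp_of_ge (by linarith), ramp_of_ge (by linarith), ramp_of_ge (by linarith)]
      ring

omit hn in
theorem leftCoef_mem (n i : ℕ) : 1 ≤ leftCoef n i ∧ leftCoef n i ≤ 2 := by
  unfold leftCoef
  split_ifs <;> norm_num

omit hn in
theorem abs_rightCoef_mem (i : ℕ) : 1 ≤ |rightCoef i| ∧ |rightCoef i| ≤ 2 := by
  unfold rightCoef
  split_ifs <;> norm_num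

theorem abs_baseCDF_sub_self_le {e : ℕ → ℝ} (he : ∀ k, |e k| ≤ 1) (M i : ℕ) (y : ℝ) :
    |baseCDF n M e i y - y| ≤ 4 * windowWidth n 0 := by
  have hw := (windowWidth_pos hn 0).le
  by_cases hi : i < 3
  · have h1 := abs_wiggle_le hn he M (y - 1 / n)
    have h2 := abs_wiggle_le hn he M (y - 2 / n)
    have h3 : |leftCoef n i * wiggle n M e (y - 1 / n)| ≤ 2 * (windowWidth n 0 / 16) := by
      rw [abs_mul, abs_of_pos (by linarith [(leftCoef_mem n i).1])]
      have := leftCoef_mem n i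
      gcongr
      exact this.2
    have h4 : |rightCoef i * wiggle n M e (y - 2 / n)| ≤ 2 * (windowWidth n 0 / 16) := by
      rw [abs_mul]
      have := abs_rightCoef_mem i
      gcongr
      exact this.2
    rw [baseCDF, if_pos hi]
    have h3 := abs_le.1 h3
    have h4 := abs_le.1 h4
    exact abs_le.2 ⟨by linarith, by linarith⟩
  · have h1 := abs_le.1 (abs_clampTo_le hw (y - 1 / n))
    have h2 := abs_le.1 (abs_clampTo_le hw (y - 2 / n))
    have h3 := ramp_nonneg (n * y)
    have h4 := ramp_nonneg (n * y - 1)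
    have h5 := ramp_nonneg (n * y - 2)
    have h6 := ramp_le_one (n * y)
    have h7 := ramp_le_one (n * y - 1)
    have h8 := ramp_le_one (n * y - 2)
    rw [baseCDF, if_neg hi]
    have : |ramp (n * y) + 2 * ramp (n * y - 1) + ramp (n * y - 2) - 2| ≤ 2 :=
      abs_le.2 ⟨by linarith, by linarith⟩
    have h9 : |windowWidth n 0 * (ramp (n * y) + 2 * ramp (n * y - 1) + ramp (n * y - 2) - 2)| ≤
        windowWidth n 0 * 2 := by
      rw [abs_mul, abs_of_nonneg hw]
      gcongr
    have h9 := abs_le.1 h9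
    exact abs_le.2 ⟨by linarith, by linarith⟩

/-- The active players have positive value everywhere. -/
theorem baseCDF_active_sub {e : ℕ → ℝ} (he : ∀ k, |e k| ≤ 1) (M : ℕ) {i : ℕ} (hi : i < 3)
    {x y : ℝ} (hxy : x ≤ y) :
    3 / 4 * (y - x) ≤ baseCDF n M e i y - baseCDF n M e i x ∧
      baseCDF n M e i y - baseCDF n M e i x ≤ 5 / 4 * (y - x) := by
  have h1 := abs_wiggle_sub_le hn he M (x - 1 / n) (y - 1 / n)
  have h2 := abs_wiggle_sub_le hn he M (x - 2 / n) (y - 2 / n)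
  rw [sub_sub_sub_cancel_right, abs_of_nonneg (sub_nonneg.2 hxy)] at h1 h2
  have h3 : |leftCoef n i * (wiggle n M e (y - 1 / n) - wiggle n M e (x - 1 / n))| ≤
      2 * ((y - x) / 16) := by
    rw [abs_mul, abs_of_pos (by linarith [(leftCoef_mem n i).1])]
    have := leftCoef_mem n i
    gcongr
    exact this.2
  have h4 : |rightCoef i * (wiggle n M e (y - 2 / n) - wiggle n M e (x - 2 / n))| ≤
      2 * ((y - x) / 16) := by
    rw [abs_mul]
    have := abs_rightCoef_mem i
    gcongr
    exact this.2
  rw [baseCDF, baseCDF, if_pos hi, if_pos hi]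
  have h3 := abs_le.1 h3
  have h4 := abs_le.1 h4
  constructor <;> linarith

theorem baseCDF_sub {e : ℕ → ℝ} (he : ∀ k, |e k| ≤ 1) (M i : ℕ) {x y : ℝ} (hxy : x ≤ y) :
    0 ≤ baseCDF n M e i y - baseCDF n M e i x ∧
      baseCDF n M e i y - baseCDF n M e i x ≤ 2 * (y - x) := by
  by_cases hi : i < 3
  · have := baseCDF_active_sub hn he M hi hxy
    constructor <;> linarith
  · have h3 := three_le_cast hn
    have h0 : (0 : ℝ) < n := by linarith
    have hw := (windowWidth_pos hn 0).le
    have hwn := windowWidth_mul_le hn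
    have hxy' : (n : ℝ) * x ≤ n * y := by gcongr
    have h1 := ramp_mono hxy'
    have h2 := ramp_mono (sub_le_sub_right hxy' 1)
    have h4 := ramp_mono (sub_le_sub_right hxy' 2)
    have h5 := ramp_sub_le hxy'
    have h6 := ramp_sub_le (sub_le_sub_right hxy' 1)
    have h7 := ramp_sub_le (sub_le_sub_right hxy' 2)
    have h8 : 1 / (n : ℝ) + windowWidth n 0 ≤ 2 / n - windowWidth n 0 := by
      have : windowWidth n 0 ≤ 1 / 2 * (1 / n) := by
        rw [← div_eq_mul_one_div, le_div_iff₀ h0]; linarith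
      have h9 : (2 : ℝ) / n = 1 / n + 1 / n := by ring
      linarith
    have h9 := clampTo_add_clampTo_le hw h8 hxy
    have h10 := clampTo_mono (windowWidth n 0) (sub_le_sub_right hxy (1 / (n : ℝ)))
    have h11 := clampTo_mono (windowWidth n 0) (sub_le_sub_right hxy (2 / (n : ℝ)))
    have h12 : 0 ≤ windowWidth n 0 * ((ramp (n * y) + 2 * ramp (n * y - 1) + ramp (n * y - 2)) -
        (ramp (n * x) + 2 * ramp (n * x - 1) + ramp (n * x - 2))) :=
      mul_nonneg hw (by linarith)
    have h13 : windowWidth n 0 * ((ramp (n * y) + 2 * ramp (n * y - 1) + ramp (n * y - 2)) -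
        (ramp (n * x) + 2 * ramp (n * x - 1) + ramp (n * x - 2))) ≤
        windowWidth n 0 * (8 * (n * y - n * x)) :=
      mul_le_mul_of_nonneg_left (by linarith) hw
    have h14 : windowWidth n 0 * n * (y - x) ≤ 1 / 57600 * (y - x) :=
      mul_le_mul_of_nonneg_right hwn (sub_nonneg.2 hxy)
    rw [baseCDF, baseCDF, if_neg hi, if_neg hi]
    constructor <;> nlinarith

theorem playerCDF_sub {e : ℕ → ℝ} (he : ∀ k, |e k| ≤ 1) (M i : ℕ) {x y : ℝ} (hxy : x ≤ y) :
    (1 - liking n) * (baseCDF n M e i y - baseCDF n M e i x) ≤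
        playerCDF n M e i y - playerCDF n M e i x ∧
      playerCDF n M e i y - playerCDF n M e i x ≤ 3 * (y - x) := by
  have h3 := three_le_cast hn
  have h0 : (0 : ℝ) < n := by linarith
  have hl := liking_pos hn
  have hl' := liking_le hn
  have hln := liking_mul_le hn
  have hxy' : (n : ℝ) * x ≤ n * y := by gcongr
  have h1 := ramp_mono (sub_le_sub_right hxy' i)
  have h2 := ramp_mono (sub_le_sub_right hxy' (nextPiece n i))
  have h4 := ramp_sub_le (sub_le_sub_right hxy' i)
  have h5 := ramp_sub_le (sub_le_sub_right hxy' (nextPiece n i))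
  have h6 := baseCDF_sub hn he M i hxy
  unfold playerCDF
  constructor
  · have := mul_nonneg hl.le (add_nonneg (sub_nonneg.2 h1) (sub_nonneg.2 h2))
    nlinarith
  · have h7 : (1 - liking n) * (baseCDF n M e i y - baseCDF n M e i x) ≤ 2 * (y - x) :=
      (mul_le_of_le_one_left h6.1 (by linarith)).trans h6.2
    have h8 : liking n / 2 * ((ramp (n * y - i) + ramp (n * y - nextPiece n i)) -
        (ramp (n * x - i) + ramp (n * x - nextPiece n i))) ≤
        liking n / 2 * (4 * (n * y - n * x)) :=
      mul_le_mul_of_nonneg_left (by linarith) (by linarith)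
    have h9 : liking n * n * (y - x) ≤ 1 / 96 * (y - x) :=
      mul_le_mul_of_nonneg_right hln (sub_nonneg.2 hxy)
    linarith

theorem playerCDF_mono {e : ℕ → ℝ} (he : ∀ k, |e k| ≤ 1) (M i : ℕ) :
    Monotone (playerCDF n M e i) := fun x y hxy => by
  have h1 := (playerCDF_sub hn he M i hxy).1
  have h2 := mul_nonneg (by linarith [liking_le hn] : 0 ≤ 1 - liking n)
    (baseCDF_sub hn he M i hxy).1
  linarith

theorem playerCDF_lipschitz {e : ℕ → ℝ} (he : ∀ k, |e k| ≤ 1) (M i : ℕ) :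
    LipschitzWith 3 (playerCDF n M e i) := by
  refine LipschitzWith.of_le_add_mul _ fun x y => ?_
  rcases le_total x y with h | h
  · have := playerCDF_mono hn he M i h
    have := mul_nonneg (by norm_num : (0 : ℝ) ≤ (3 : NNReal)) (dist_nonneg (x := x) (y := y))
    linarith
  · have := (playerCDF_sub hn he M i h).2
    rw [Real.dist_eq, abs_of_nonneg (sub_nonneg.2 h)]
    push_cast
    linarith

omit hn in
/-- The distribution function near a multiple of `1/n`. -/
theorem playerCDF_zone (M : ℕ) (e : ℕ → ℝ) (i : ℕ) {k : ℕ} {y : ℝ} (h : |n * y - k| ≤ 1 / 4) :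
    playerCDF n M e i y = (1 - liking n) * baseCDF n M e i y +
      liking n / 2 * ((if i < k then 1 else 0) + if nextPiece n i < k then 1 else 0) := by
  rw [playerCDF, ramp_zone h, ramp_zone h]

theorem nextPiece_lt {i : ℕ} (hi : i < n) : nextPiece n i < n := by
  unfold nextPiece
  split_ifs <;> omega

theorem playerCDF_zero (M : ℕ) (e : ℕ → ℝ) (i : ℕ) : playerCDF n M e i 0 = 0 := by
  have h : |(n : ℝ) * 0 - (0 : ℕ)| ≤ 1 / 4 := by norm_num
  rw [playerCDF_zone M e i h, baseCDF_other hn M e i (by norm_num) (by norm_num) h]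
  simp

theorem playerCDF_one (M : ℕ) (e : ℕ → ℝ) {i : ℕ} (hi : i < n) : playerCDF n M e i 1 = 1 := by
  have h : |(n : ℝ) * 1 - n| ≤ 1 / 4 := by norm_num
  rw [playerCDF_zone M e i h, baseCDF_other hn M e i (by omega) (by omega) h, if_pos hi,
    if_pos (nextPiece_lt hn hi)]
  ring

theorem abs_playerCDF_sub_self_le {e : ℕ → ℝ} (he : ∀ k, |e k| ≤ 1) (M i : ℕ) {y : ℝ}
    (hy : y ∈ Icc (0 : ℝ) 1) :
    |playerCDF n M e i y - y| ≤ 4 * windowWidth n 0 + liking n := by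
  have h1 := abs_le.1 (abs_baseCDF_sub_self_le hn he M i y)
  have hl := liking_pos hn
  have hl' := liking_le hn
  have hw := (windowWidth_pos hn 0).le
  have h2 := ramp_nonneg (n * y - i)
  have h3 := ramp_nonneg (n * y - nextPiece n i)
  have h4 := ramp_le_one (n * y - i)
  have h5 := ramp_le_one (n * y - nextPiece n i)
  unfold playerCDF
  set R := ramp (n * y - i) + ramp (n * y - nextPiece n i)
  have h6 : |(1 - liking n) * (baseCDF n M e i y - y)| ≤ 4 * windowWidth n 0 := by
    rw [abs_mul, abs_of_nonneg (by linarith)]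
    exact (mul_le_of_le_one_left (abs_nonneg _) (by linarith)).trans (abs_le.2 h1)
  have h7 : |liking n * (R / 2 - y)| ≤ liking n := by
    rw [abs_mul, abs_of_pos hl]
    refine mul_le_of_le_one_right hl.le (abs_le.2 ⟨?_, ?_⟩) <;> linarith [hy.1, hy.2]
  have h8 : (1 - liking n) * baseCDF n M e i y + liking n / 2 * R - y =
      (1 - liking n) * (baseCDF n M e i y - y) + liking n * (R / 2 - y) := by ring
  rw [h8]
  exact (abs_add_le _ _).trans (add_le_add h6 h7)

end

/-- The sequence of signs encoded by a sequence of bits. -/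
def signs (e : ℕ → Bool) (k : ℕ) : ℝ := if e k then 1 else -1

theorem abs_signs_le (e : ℕ → Bool) (k : ℕ) : |signs e k| ≤ 1 := by
  unfold signs
  split_ifs <;> norm_num

/-- The valuation of player `i` that is encoded by `e`. -/
def playerValuation {n : ℕ} (hn : 3 ≤ n) (M : ℕ) (e : ℕ → Bool) (i : Fin n) : CakeValuation :=
  CakeValuation.ofCDF (playerCDF n M (signs e) i) (playerCDF_mono hn (abs_signs_le e) M i)
    (playerCDF_lipschitz hn (abs_signs_le e) M i) (playerCDF_zero hn M _ i)
    (playerCDF_one hn M _ i.2)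

theorem playerValuation_value {n : ℕ} (hn : 3 ≤ n) (M : ℕ) (e : ℕ → Bool) (i : Fin n) {y : ℝ}
    (hy : 0 ≤ y) :
    (playerValuation hn M e i).value (Icc 0 y) = playerCDF n M (signs e) i y :=
  CakeValuation.ofCDF_value _ _ _ _ _ hy

/-! ### Answers of the adversary -/

/-- The points outside the two windows of level `m`. -/
def outsideWindows (n m : ℕ) : Set ℝ :=
  {y | windowWidth n m ≤ |y - 1 / n| ∧ windowWidth n m ≤ |y - 2 / n|}

section

variable {n : ℕ} (hn : 3 ≤ n)
include hn

theorem outsideWindows_mono {m m' : ℕ} (h : m ≤ m') :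
    outsideWindows n m ⊆ outsideWindows n m' := fun _ hy =>
  ⟨(windowWidth_anti hn h).trans hy.1, (windowWidth_anti hn h).trans hy.2⟩

/-- Outside the windows of level `m`, a valuation depends only on the first `m` signs. -/
theorem playerCDF_congr (M : ℕ) {e e' : ℕ → ℝ} {m : ℕ} (he : ∀ k < m, e k = e' k) (i : ℕ) {y : ℝ}
    (hy : y ∈ outsideWindows n m) : playerCDF n M e i y = playerCDF n M e' i y := by
  unfold playerCDF baseCDF
  rw [wiggle_congr hn M he hy.1, wiggle_congr hn M he hy.2]

theorem playerCDF_strictMono {e : ℕ → ℝ} (he : ∀ k, |e k| ≤ 1) (M : ℕ) {i : ℕ} (hi : i < 3) :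
    StrictMono (playerCDF n M e i) := fun x y hxy => by
  have h1 := (playerCDF_sub hn he M i hxy.le).1
  have h2 := (baseCDF_active_sub hn he M hi hxy.le).1
  have h3 := mul_pos (by linarith [liking_le hn] : 0 < 1 - liking n)
    (by linarith : 0 < baseCDF n M e i y - baseCDF n M e i x)
  linarith

/-- A cut query of an inactive player is never answered inside the windows. -/
theorem cutPoint_dummy_mem {i : Fin n} (hi : ¬ (i : ℕ) < 3) (M : ℕ) (e : ℕ → Bool)
    (α : Icc (0 : ℝ) 1) {m : ℕ} : (playerValuation hn M e i).cutPoint α ∈ outsideWindows n m := by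
  have hleast := (playerValuation hn M e i).isLeast_cutPoint α
  set p := (playerValuation hn M e i).cutPoint α
  have hw := windowWidth_pos hn 0
  have hwn := windowWidth_mul_le hn
  have h3 := three_le_cast hn
  have h0 : (0 : ℝ) < n := by linarith
  have key : ∀ j : ℕ, (j = 1 ∨ j = 2) → windowWidth n 0 ≤ |p - (j : ℝ) / n| := by
    intro j hj
    by_contra hlt
    push Not at hlt
    have hlt' := abs_lt.1 hlt
    -- The distribution function is constant on the window, so its left end `p'` has the same value
    -- as `p` and contradicts leftmostness.
    set p' := (j : ℝ) / n - windowWidth n 0 with hp'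
    have hd : clampTo (windowWidth n 0) (p - (j : ℝ) / n) = p - (j : ℝ) / n :=
      clampTo_of_abs_le hlt.le
    have hd' : clampTo (windowWidth n 0) (p' - (j : ℝ) / n) = p' - (j : ℝ) / n := by
      apply clampTo_of_abs_le
      rw [hp', sub_sub_cancel_left, abs_neg, abs_of_pos hw]
    have hz : |n * p - j| ≤ 1 / 4 := abs_mul_sub_le hn hlt.le
    have hz' : |n * p' - j| ≤ 1 / 4 := by
      apply abs_mul_sub_le hn
      rw [hp', sub_sub_cancel_left, abs_neg, abs_of_pos hw]
    have hj1 : (1 : ℝ) ≤ j := by rcases hj with rfl | rfl <;> norm_num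
    have hp0 : 0 ≤ p' := by
      have : windowWidth n 0 ≤ (j : ℝ) / n := by
        rw [le_div_iff₀ h0]
        linarith
      linarith
    have hlt2 : p' < p := by linarith
    have hb : baseCDF n M (signs e) i p = baseCDF n M (signs e) i p' := by
      rcases hj with rfl | rfl
      · push_cast at hz hz' hd hd'
        rw [baseCDF_dummy_one hn M _ hi hz, baseCDF_dummy_one hn M _ hi hz', hd, hd']
        ring
      · push_cast at hz hz' hd hd'
        rw [baseCDF_dummy_two hn M _ hi hz, baseCDF_dummy_two hn M _ hi hz', hd, hd']
        ring
    have hG : playerCDF n M (signs e) i p = playerCDF n M (signs e) i p' := by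
      rw [playerCDF_zone M _ _ hz, playerCDF_zone M _ _ hz', hb]
    refine absurd (hleast.2 ⟨⟨hp0, hlt2.le.trans hleast.1.1.2⟩, ?_⟩) (not_le.2 hlt2)
    rw [playerValuation_value hn M e i hp0, ← hG,
      ← playerValuation_value hn M e i hleast.1.1.1]
    exact hleast.1.2
  have hm := windowWidth_anti hn (Nat.zero_le m)
  have k1 := key 1 (.inl rfl)
  have k2 := key 2 (.inr rfl)
  push_cast at k1 k2
  exact ⟨hm.trans k1, hm.trans k2⟩

/-- If the answer to a cut query lies inside a window, then the value asked for lies inside an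
interval that is determined by the signs. -/
theorem exists_window_of_cutPoint_notMem {i : Fin n} (hi : (i : ℕ) < 3) (M : ℕ) (e : ℕ → Bool)
    (α : Icc (0 : ℝ) 1) {m : ℕ}
    (h : (playerValuation hn M e i).cutPoint α ∉ outsideWindows n m) :
    (|α - ((1 - liking n) * (1 / n + leftCoef n i * wiggle n M (signs e) (windowWidth n m)) +
        liking n / 2 * ((if (i : ℕ) < 1 then 1 else 0) + if nextPiece n i < 1 then 1 else 0))| <
        (1 - liking n) * windowWidth n m ∧
      (α : ℝ) < playerCDF n M (signs e) i (3 / 2 / n)) ∨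
    (|α - ((1 - liking n) * (2 / n + rightCoef i * wiggle n M (signs e) (windowWidth n m)) +
        liking n / 2 * ((if (i : ℕ) < 2 then 1 else 0) + if nextPiece n i < 2 then 1 else 0))| <
        (1 - liking n) * windowWidth n m ∧
      playerCDF n M (signs e) i (3 / 2 / n) < α) := by
  have hleast := (playerValuation hn M e i).isLeast_cutPoint α
  set p := (playerValuation hn M e i).cutPoint α
  have hα : playerCDF n M (signs e) i p = α := by
    rw [← playerValuation_value hn M e i hleast.1.1.1]
    exact hleast.1.2
  have hmono := playerCDF_strictMono hn (abs_signs_le e) M hi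
  have hw := windowWidth_pos hn m
  have hw0 := windowWidth_anti hn (Nat.zero_le m)
  have h3 := three_le_cast hn
  have h0 : (0 : ℝ) < n := by linarith
  have hmid : ∀ {j : ℝ}, |p - j / n| < windowWidth n m → |n * p - j| ≤ 1 / 4 := fun hj =>
    abs_mul_sub_le hn (hj.le.trans hw0)
  have hpm : windowWidth n m - -windowWidth n m = 2 * windowWidth n m := by ring
  simp only [outsideWindows, mem_ofPred_eq, not_and_or, not_le] at h
  rcases h with h | h
  · left
    have hz := abs_le.1 (hmid h)
    have h' := abs_lt.1 h
    -- The deviation is even, so both edges carry the same deviation and their values are a common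
    -- centre plus or minus `(1 - liking n) * windowWidth n m`.
    have hval : ∀ s : ℝ, |s| = windowWidth n m → playerCDF n M (signs e) i (1 / n + s) =
        (1 - liking n) * (1 / n + leftCoef n i * wiggle n M (signs e) (windowWidth n m)) +
        liking n / 2 * ((if (i : ℕ) < 1 then 1 else 0) + if nextPiece n i < 1 then 1 else 0) +
        (1 - liking n) * s := by
      intro s hs
      have hzs : |n * (1 / n + s) - (1 : ℝ)| ≤ 1 / 4 := abs_mul_sub_le hn (by
        rw [add_sub_cancel_left, hs]; exact hw0)
      rw [playerCDF_zone (k := 1) M _ _ (by simpa using hzs), baseCDF_active_one hn M _ hi hzs,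
        add_sub_cancel_left, ← wiggle_abs n M _ s, hs]
      ring
    refine ⟨abs_lt.2 ⟨?_, ?_⟩, ?_⟩
    · have := hmono (show 1 / n + -windowWidth n m < p by linarith)
      rw [hval _ (by rw [abs_neg, abs_of_pos hw]), hα] at this
      linarith
    · have := hmono (show p < 1 / n + windowWidth n m by linarith)
      rw [hval _ (abs_of_pos hw), hα] at this
      linarith
    · rw [← hα]
      apply hmono
      rw [lt_div_iff₀ h0]
      linarith
  · right
    have hz := abs_le.1 (hmid h)
    have h' := abs_lt.1 h
    have hval : ∀ s : ℝ, |s| = windowWidth n m → playerCDF n M (signs e) i (2 / n + s) =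
        (1 - liking n) * (2 / n + rightCoef i * wiggle n M (signs e) (windowWidth n m)) +
        liking n / 2 * ((if (i : ℕ) < 2 then 1 else 0) + if nextPiece n i < 2 then 1 else 0) +
        (1 - liking n) * s := by
      intro s hs
      have hzs : |n * (2 / n + s) - (2 : ℝ)| ≤ 1 / 4 := abs_mul_sub_le hn (by
        rw [add_sub_cancel_left, hs]; exact hw0)
      rw [playerCDF_zone (k := 2) M _ _ (by simpa using hzs), baseCDF_active_two hn M _ hi hzs,
        add_sub_cancel_left, ← wiggle_abs n M _ s, hs]
      ring
    refine ⟨abs_lt.2 ⟨?_, ?_⟩, ?_⟩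
    · have := hmono (show 2 / n + -windowWidth n m < p by linarith)
      rw [hval _ (by rw [abs_neg, abs_of_pos hw]), hα] at this
      linarith
    · have := hmono (show p < 2 / n + windowWidth n m by linarith)
      rw [hval _ (abs_of_pos hw), hα] at this
      linarith
    · rw [← hα]
      apply hmono
      rw [div_lt_iff₀ h0]
      linarith

omit hn in
-- The centres are `2 * r * |c| * w ≥ 2 * r * w` apart, so open intervals of radius `r * w` around
-- them are disjoint.
theorem abs_sub_lt_disjoint {a c r W W' w R : ℝ} (hr : 0 < r) (hw : 0 < w) {x : ℝ}
    (hc : 1 ≤ |c|) (hW : W - W' = 2 * w)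
    (h : |a - (r * (x + c * W) + R)| < r * w) (h' : |a - (r * (x + c * W') + R)| < r * w) :
    False := by
  have h2 : |(a - (r * (x + c * W') + R)) - (a - (r * (x + c * W) + R))| < r * w + r * w :=
    (abs_sub _ _).trans_lt (add_lt_add h' h)
  have h3 : (a - (r * (x + c * W') + R)) - (a - (r * (x + c * W) + R)) = r * c * (W - W') := by
    ring
  rw [h3, hW, abs_mul, abs_mul, abs_of_pos hr, abs_of_pos (by linarith : 0 < 2 * w)] at h2
  nlinarith [mul_pos hr hw]

/-- The adversary's choice: some value of the sign of level `m` guarantees that the answer to a cut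
query lies outside the windows of level `m + 1`. -/
theorem exists_sign (i : Fin n) {M m : ℕ} (hm : m < M) (e : ℕ → Bool) (α : Icc (0 : ℝ) 1) :
    ∃ b, ∀ e' : ℕ → Bool, (∀ k < m, e' k = e k) → e' m = b →
      (playerValuation hn M e' i).cutPoint α ∈ outsideWindows n (m + 1) := by
  by_cases hi : (i : ℕ) < 3
  swap
  · exact ⟨true, fun e' _ _ => cutPoint_dummy_mem hn hi M e' α⟩
  by_contra hno
  push Not at hno
  obtain ⟨e₁, he₁, hb₁, h₁⟩ := hno true
  obtain ⟨e₂, he₂, hb₂, h₂⟩ := hno false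
  have hr : 0 < 1 - liking n := by linarith [liking_le hn]
  have hw := windowWidth_pos hn (m + 1)
  have hW : wiggle n M (signs e₁) (windowWidth n (m + 1)) -
      wiggle n M (signs e₂) (windowWidth n (m + 1)) = 2 * windowWidth n (m + 1) := by
    rw [wiggle_sub_wiggle hn hm _ (abs_of_pos hw)]
    · simp only [signs, hb₁, hb₂]
      norm_num
    · intro k hk
      simp only [signs, he₁ k hk, he₂ k hk]
  -- The point `3/(2n)` is outside all windows, so its value is independent of the signs. Comparing
  -- it with `α` decides which window can catch the answer, and one sign suffices for both windows.
  have hmid : playerCDF n M (signs e₁) i (3 / 2 / n) = playerCDF n M (signs e₂) i (3 / 2 / n) := by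
    refine playerCDF_congr hn M (m := 0) (by simp) i ⟨?_, ?_⟩ <;>
    · apply windowWidth_le_abs_sub hn
      have h0 : (n : ℝ) ≠ 0 := by linarith [three_le_cast hn]
      rw [mul_div_cancel₀ _ h0]
      norm_num
  have hl := (leftCoef_mem n i).1.trans (le_abs_self _)
  have hr' := (abs_rightCoef_mem i).1
  rcases exists_window_of_cutPoint_notMem hn hi M e₁ α h₁ with h1 | h1 <;>
    rcases exists_window_of_cutPoint_notMem hn hi M e₂ α h₂ with h2 | h2
  · exact abs_sub_lt_disjoint hr hw hl hW h1.1 h2.1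
  · linarith [h1.2, h2.2]
  · linarith [h1.2, h2.2]
  · exact abs_sub_lt_disjoint hr hw hr' hW h1.1 h2.1

/-- If the answers to a cut query lie outside the windows of level `m` for two instances with the
same first `m` signs, then they agree. -/
theorem cutPoint_congr (i : Fin n) (M : ℕ) {m : ℕ} {e e' : ℕ → Bool} (he : ∀ k < m, e k = e' k)
    (α : Icc (0 : ℝ) 1) (h : (playerValuation hn M e i).cutPoint α ∈ outsideWindows n m)
    (h' : (playerValuation hn M e' i).cutPoint α ∈ outsideWindows n m) :
    (playerValuation hn M e i).cutPoint α = (playerValuation hn M e' i).cutPoint α := by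
  have aux : ∀ {e e' : ℕ → Bool}, (∀ k < m, e k = e' k) →
      (playerValuation hn M e i).cutPoint α ∈ outsideWindows n m →
      (playerValuation hn M e' i).cutPoint α ≤ (playerValuation hn M e i).cutPoint α := by
    intro e e' he h
    have h1 := ((playerValuation hn M e i).isLeast_cutPoint α).1
    refine ((playerValuation hn M e' i).isLeast_cutPoint α).2 ⟨h1.1, ?_⟩
    rw [playerValuation_value hn M e' i h1.1.1, ← h1.2, playerValuation_value hn M e i h1.1.1]
    exact playerCDF_congr hn M (fun k hk => by simp only [signs, he k hk]) i h
  exact le_antisymm (aux (fun k hk => (he k hk).symm) h') (aux he h)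

end

/-! ### Envy conditions on the displacements of the cuts -/

/-- An almost convex sequence whose end is at least as high as its start does not fall much in
its last step. -/
theorem last_step_ge_of_almost_convex {f : ℕ → ℝ} {N : ℕ} {δ : ℝ} (hδ : 0 ≤ δ)
    (hf : ∀ i, i + 1 < N → -δ ≤ f (i + 2) - 2 * f (i + 1) + f i) (hN : 0 < N)
    (h : f 0 ≤ f N) : -(N * δ) ≤ f N - f (N - 1) := by
  obtain ⟨K, rfl⟩ : ∃ K, N = K + 1 := ⟨N - 1, by omega⟩
  rw [Nat.add_sub_cancel]
  have h1 : ∀ j, j ≤ K → f (K - j + 1) - f (K - j) ≤ f (K + 1) - f K + j * δ := by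
    intro j
    induction j with
    | zero => intro _; simp
    | succ j ih =>
      intro hj
      have h2 := ih (by omega)
      have h3 := hf (K - (j + 1)) (by omega)
      rw [show K - (j + 1) + 2 = K - j + 1 by omega, show K - (j + 1) + 1 = K - j by omega] at h3
      rw [show K - (j + 1) + 1 = K - j by omega]
      push_cast
      linarith
  by_contra hlt
  push Not at hlt
  -- No step exceeds the last one by more than `K * δ`, so a last step below `-(K + 1) * δ` would
  -- make every step negative.
  have h4 : ∀ j, j ≤ K + 1 → f j ≤ f 0 ∧ (0 < j → f j < f 0) := by
    intro j
    induction j with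
    | zero => intro _; simp
    | succ j ih =>
      intro hj
      have h5 := (ih (by omega)).1
      have h6 := h1 (K - j) (by omega)
      rw [show K - (K - j) = j by omega] at h6
      have h7 : ((K - j : ℕ) : ℝ) * δ ≤ ((K + 1 : ℕ) : ℝ) * δ := by
        gcongr
        omega
      exact ⟨by linarith, fun _ => by linarith⟩
  have := (h4 (K + 1) le_rfl).2 hN
  linarith

/-- An almost convex sequence whose end is at most as high as its start does not rise much in
its first step. -/
theorem first_step_le_of_almost_convex {f : ℕ → ℝ} {N : ℕ} {δ : ℝ} (hδ : 0 ≤ δ)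
    (hf : ∀ i, i + 1 < N → -δ ≤ f (i + 2) - 2 * f (i + 1) + f i) (hN : 0 < N)
    (h : f N ≤ f 0) : f 1 - f 0 ≤ N * δ := by
  have := last_step_ge_of_almost_convex (f := fun i => f (N - i)) hδ (N := N)
    (fun i hi => by
      have := hf (N - (i + 2)) (by omega)
      rw [show N - (i + 2) + 2 = N - i by omega, show N - (i + 2) + 1 = N - (i + 1) by omega]
        at this
      linarith) hN (by simpa using h)
  simp only [Nat.sub_self, show N - (N - 1) = 1 by omega] at this
  linarith

/-- Displacements of the first two cuts out of the windows are incompatible with the envy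
conditions. -/
theorem displacement_contradiction {u v w δ η X₀ X₁ X₂ Y₀ Y₁ Y₂ Z : ℝ} (hw : 0 < w)
    (hη : 6 * η + 6 * δ < w) (hδ : 0 ≤ δ) (hη0 : 0 ≤ η)
    (hu : w ≤ |u|) (hv : w ≤ |v|)
    (hX₀ : |X₀ - u| ≤ |u| / 8) (hX₁ : |X₁ - u| ≤ |u| / 8) (hX₂ : |X₂ - u| ≤ |u| / 8)
    (hY₀ : |Y₀ - v| ≤ |v| / 8) (hY₁ : |Y₁ - v| ≤ |v| / 8)
    (h₀ : -δ ≤ 2 * X₀ - Y₀) (h₁ : v < 0 → X₁ ≤ Y₁ + η)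
    (h₂ : -δ ≤ Z - Y₂ - X₂) (hZ : 0 < v → Z ≤ Y₂ - 7 / 8 * w + η) : False := by
  have hX₀ := abs_le.1 hX₀
  have hX₁ := abs_le.1 hX₁
  have hX₂ := abs_le.1 hX₂
  have hY₀ := abs_le.1 hY₀
  have hY₁ := abs_le.1 hY₁
  -- For `v > 0`, `h₂` and `hZ` force `u < 0`, against `h₀`. For `v < 0`, `h₁` forces `u < 0`; then
  -- `h₁` and `h₀` give `9|u| ≥ 7|v| - 8η` and `14|u| ≤ 9|v| + 8δ`, hence `17|u| ≤ 72η + 56δ < 12w`.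
  rcases le_total 0 v with hv0 | hv0
  · rw [abs_of_nonneg hv0] at *
    have := hZ (by linarith)
    rcases le_total 0 u with hu0 | hu0
    · rw [abs_of_nonneg hu0] at *
      linarith
    · rw [abs_of_nonpos hu0] at *
      linarith
  · rw [abs_of_nonpos hv0] at *
    have := h₁ (by linarith)
    rcases le_total 0 u with hu0 | hu0
    · rw [abs_of_nonneg hu0] at *
      linarith
    · rw [abs_of_nonpos hu0] at *
      linarith

/-- If every player has one of the two pieces they like, then either every player `i` has piece `i`
or every player `i` has piece `nextPiece n i`. -/
theorem perm_eq_or_eq_nextPiece {n : ℕ} (hn : 3 ≤ n) (π : Equiv.Perm (Fin n))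
    (h : ∀ i, (π i : ℕ) = i ∨ (π i : ℕ) = nextPiece n i) :
    (∀ i, (π i : ℕ) = i) ∨ ∀ i, (π i : ℕ) = nextPiece n i := by
  have step : ∀ a b (ha : a < n) (hb : b < n), a ≠ b → nextPiece n a = b →
      (π ⟨b, hb⟩ : ℕ) = b → (π ⟨a, ha⟩ : ℕ) = a := by
    intro a b ha hb hab hnext hfix
    refine (h ⟨a, ha⟩).resolve_right fun h' => hab ?_
    have : π ⟨a, ha⟩ = π ⟨b, hb⟩ := Fin.ext (by rw [h', hfix]; exact hnext)
    simpa using π.injective this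
  have chain : ∀ k j, 2 ≤ k → k ≤ j → ∀ (hk : k < n) (hj : j < n),
      (π ⟨k, hk⟩ : ℕ) = k → (π ⟨j, hj⟩ : ℕ) = j := by
    intro k j hk2 hkj
    induction j, hkj using Nat.le_induction with
    | base => exact fun _ _ h => h
    | succ j hkj ih =>
      intro hk hj hfix
      refine step (j + 1) j hj (by omega) (by omega) ?_ (ih hk (by omega) hfix)
      simp [nextPiece, show ¬ j = 0 by omega, show ¬ j = 1 by omega]
  have one_of : ∀ k (hk : k < n), 2 ≤ k → (π ⟨k, hk⟩ : ℕ) = k →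
      (π ⟨1, by omega⟩ : ℕ) = 1 := fun k hk hk2 hfix =>
    step 1 (n - 1) (by omega) (by omega) (by omega) (by simp [nextPiece])
      (chain k (n - 1) hk2 (by omega) hk (by omega) hfix)
  have zero_of_one : (π ⟨1, by omega⟩ : ℕ) = 1 → (π ⟨0, by omega⟩ : ℕ) = 0 :=
    step 0 1 (by omega) (by omega) (by omega) (by simp [nextPiece])
  -- A fixed piece is unavailable to its predecessor in the cycle, so one fixed point propagates
  -- backwards to all players.
  by_cases h0 : (π ⟨0, by omega⟩ : ℕ) = 0
  · left
    have h2 := step 2 0 (by omega) (by omega) (by omega) (by simp [nextPiece]) h0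
    rintro ⟨i, hi⟩
    by_cases hi0 : i = 0
    · subst hi0; exact h0
    by_cases hi1 : i = 1
    · subst hi1; exact one_of 2 (by omega) le_rfl h2
    · exact chain 2 i le_rfl (by omega) _ _ h2
  · right
    rintro ⟨i, hi⟩
    refine (h ⟨i, hi⟩).resolve_left fun hfix => h0 ?_
    by_cases hi0 : i = 0
    · subst hi0; exact hfix
    by_cases hi1 : i = 1
    · subst hi1; exact zero_of_one hfix
    · exact zero_of_one (one_of i hi (by omega) hfix)

theorem clampTo_of_nonneg {w v : ℝ} (hw : 0 ≤ w) (hv : 0 ≤ v) : clampTo w v = min |v| w := by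
  rw [clampTo, abs_of_nonneg hv, min_comm, max_eq_right]
  exact (neg_nonpos.2 hw).trans (le_min hv hw)

theorem clampTo_neg {w : ℝ} (hw : 0 ≤ w) (v : ℝ) : clampTo w (-v) = -clampTo w v := by
  unfold clampTo
  rcases max_cases (-w) (min w (-v)) with h1 | h1 <;>
    rcases max_cases (-w) (min w v) with h2 | h2 <;>
    rcases min_cases w (-v) with h3 | h3 <;>
    rcases min_cases w v with h4 | h4 <;> linarith

section

variable {n : ℕ} (hn : 3 ≤ n)
include hn

theorem abs_mul_wiggle_le {e : ℕ → ℝ} (he : ∀ k, |e k| ≤ 1) (M : ℕ) {c s : ℝ} (hc : |c| ≤ 2)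
    (hs : |s| = 1) (u : ℝ) :
    |s * (c * (wiggle n M e u - wiggle n M e 0))| ≤ min |u| (windowWidth n 0) / 8 := by
  have := abs_wiggle_sub_zero_le hn he M u
  rw [abs_mul, abs_mul, hs, one_mul]
  calc |c| * |wiggle n M e u - wiggle n M e 0| ≤ 2 * (min |u| (windowWidth n 0) / 16) := by gcongr
    _ = _ := by ring

/-- Cuts outside the windows violate the envy conditions. -/
theorem cuts_contradiction {E : ℕ → ℕ → ℝ} (hE : ∀ i k, |E i k| ≤ 1) (M : ℕ) {t : ℕ → ℝ}
    (ht0 : t 0 = 0) (htn : t n = 1) (hz : ∀ k ≤ n, |n * t k - k| ≤ 1 / 4)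
    (h1 : t 1 ∈ outsideWindows n M) (h2 : t 2 ∈ outsideWindows n M) {δ s : ℝ} (hδ : 0 ≤ δ)
    (hδw : 6 * (n + 2) * δ < windowWidth n M) (hs : |s| = 1)
    (hq : ∀ i < n, -δ ≤ s * ((baseCDF n M (E i) i (t (i + 1)) - baseCDF n M (E i) i (t i)) -
      (baseCDF n M (E i) i (t (nextPiece n i + 1)) - baseCDF n M (E i) i (t (nextPiece n i))))) :
    False := by
  have h3 := three_le_cast hn
  have hn0 : (0 : ℝ) < n := by linarith
  have hw0 := windowWidth_pos hn 0
  have hwM := windowWidth_pos hn M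
  have hwM0 := windowWidth_anti hn (Nat.zero_le M)
  have hz1 : |n * t 1 - 1| ≤ 1 / 4 := by simpa using hz 1 (by omega)
  have hz2 : |n * t 2 - 2| ≤ 1 / 4 := by simpa using hz 2 (by omega)
  have hoth : ∀ i k, k ≤ n → k ≠ 1 → k ≠ 2 → baseCDF n M (E i) i (t k) = t k :=
    fun i k hk hk1 hk2 => baseCDF_other hn M (E i) i hk1 hk2 (hz k hk)
  have hone : ∀ i < 3, baseCDF n M (E i) i (t 1) =
      t 1 + leftCoef n i * wiggle n M (E i) (t 1 - 1 / n) :=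
    fun i hi => baseCDF_active_one hn M (E i) hi hz1
  have htwo : ∀ i < 3, baseCDF n M (E i) i (t 2) =
      t 2 + rightCoef i * wiggle n M (E i) (t 2 - 2 / n) :=
    fun i hi => baseCDF_active_two hn M (E i) hi hz2
  have q0 := hq 0 (by omega)
  have q1 := hq 1 (by omega)
  have q2 := hq 2 (by omega)
  set u := t 1 - 1 / (n : ℝ) with hu
  set v := t 2 - 2 / (n : ℝ) with hv
  have hsu : |s * u| = |u| := by rw [abs_mul, hs, one_mul]
  have hsv : |s * v| = |v| := by rw [abs_mul, hs, one_mul]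
  have hX : ∀ i, |(s * u + s * (leftCoef n i * (wiggle n M (E i) u - wiggle n M (E i) 0))) -
      s * u| ≤ |s * u| / 8 := by
    intro i
    rw [add_sub_cancel_left, hsu]
    have hc : |leftCoef n i| ≤ 2 := by
      rw [abs_of_pos] <;> linarith [(leftCoef_mem n i).1, (leftCoef_mem n i).2]
    have := abs_mul_wiggle_le hn (hE i) M hc hs u
    have := min_le_left |u| (windowWidth n 0)
    linarith
  have hY' := fun i => abs_mul_wiggle_le hn (hE i) M (abs_rightCoef_mem i).2 hs v
  have hY : ∀ i, |(s * v + s * (rightCoef i * (wiggle n M (E i) v - wiggle n M (E i) 0))) -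
      s * v| ≤ |s * v| / 8 := by
    intro i
    rw [add_sub_cancel_left, hsv]
    have := hY' i
    have := min_le_left |v| (windowWidth n 0)
    linarith
  -- the displacements as seen by the inactive players
  let f : ℕ → ℝ := fun k =>
    if k = 0 then s * (v - clampTo (windowWidth n 0) v)
    else s * (t (k + 2) - ((k + 2 : ℕ) : ℝ) / n)
  -- An inactive player compares adjacent pieces, which is a second difference of displacements. The
  -- second cut enters through its truncation because these players have no value in the window.
  have hf : ∀ i, i + 1 < n - 2 → -δ ≤ f (i + 2) - 2 * f (i + 1) + f i := by
    intro i hi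
    have h := hq (i + 3) (by omega)
    have hnext : nextPiece n (i + 3) = i + 2 := by simp [nextPiece]
    rw [hnext, hoth _ (i + 3 + 1) (by omega) (by omega) (by omega),
      hoth _ (i + 3) (by omega) (by omega) (by omega)] at h
    rcases Nat.eq_zero_or_pos i with rfl | hi0
    · rw [baseCDF_dummy_two hn M _ (by omega) hz2] at h
      simp only [f, if_true, if_false, Nat.add_eq_zero_iff, OfNat.ofNat_ne_zero, one_ne_zero,
        and_false]
      refine h.trans (le_of_eq ?_)
      rw [hv]
      push_cast
      field_simp
      ring
    · rw [hoth _ (i + 2) (by omega) (by omega) (by omega)] at h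
      simp only [f, if_neg hi0.ne', if_false, Nat.add_eq_zero_iff, OfNat.ofNat_ne_zero,
        one_ne_zero, and_false]
      refine h.trans (le_of_eq ?_)
      push_cast
      field_simp
      ring
  have hfN : f (n - 2) = 0 := by
    simp only [f, if_neg (show ¬ n - 2 = 0 by omega), show n - 2 + 2 = n by omega, htn]
    rw [div_self hn0.ne', sub_self, mul_zero]
  have hN : ((n - 2 : ℕ) : ℝ) = n - 2 := by
    push_cast [show 2 ≤ n by omega]; ring
  have hclamp : 0 ≤ s * v → s * clampTo (windowWidth n 0) v = min |v| (windowWidth n 0) := by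
    intro hsv
    rcases (abs_eq zero_le_one).1 hs with rfl | rfl
    · rw [one_mul, clampTo_of_nonneg hw0.le (by linarith)]
    · rw [neg_one_mul, ← clampTo_neg hw0.le, clampTo_of_nonneg hw0.le (by linarith), abs_neg]
  have hclamp' : s * v ≤ 0 → s * clampTo (windowWidth n 0) v = -min |v| (windowWidth n 0) := by
    intro hsv
    rcases (abs_eq zero_le_one).1 hs with rfl | rfl
    · rw [one_mul, ← neg_neg v, clampTo_neg hw0.le, clampTo_of_nonneg hw0.le (by linarith), neg_neg,
        abs_neg]
    · rw [neg_one_mul, clampTo_of_nonneg hw0.le (by linarith)]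
  have hf0 : f 0 = s * v - s * clampTo (windowWidth n 0) v := by
    simp only [f, if_true]; ring
  -- The terms `wiggle n M (E i) 0` cancel by the choice of coefficients, leaving displacements
  -- distorted by at most 1/8. The choice of `η` absorbs the `n - 2` convexity errors and one more
  -- `δ`.
  refine displacement_contradiction (u := s * u) (v := s * v) (η := (n + 1) * δ) hwM
    (by linarith) hδ (by positivity) (hsu ▸ h1.1) (hsv ▸ h2.2) (hX 0) (hX 1) (hX 2) (hY 0)
    (hY 1) ?_ ?_ (Z := s * (t 3 - 3 / n))
    (Y₂ := s * v + s * (rightCoef 2 * (wiggle n M (E 2) v - wiggle n M (E 2) 0))) ?_ ?_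
  · rw [show nextPiece n 0 = 1 by simp [nextPiece], hone 0 (by omega), htwo 0 (by omega),
      hoth 0 0 (by omega) (by omega) (by omega), ht0] at q0
    refine q0.trans (le_of_eq ?_)
    simp only [leftCoef, rightCoef, zero_ne_one, false_and, if_false, if_true, hu, hv]
    ring
  · intro hneg
    -- For `n = 3` the rival piece of player 1 is adjacent, and the comparison reads `X₁ ≤ 2 * Y₁ +
    -- δ`; this is stronger than needed as `Y₁ < 0`. For larger `n`, almost convexity keeps the last
    -- cut from yielding more than `(n - 2) * δ`.
    rcases hn.eq_or_lt with hn3 | hn4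
    · rw [show nextPiece n 1 = 2 by simp [nextPiece, ← hn3], hone 1 (by omega), htwo 1 (by omega),
        hoth 1 3 (by omega) (by omega) (by omega), show (3 : ℕ) = n from hn3, htn] at q1
      have hle := (abs_le.1 (hY 1)).2
      rw [abs_of_neg hneg] at hle
      simp only [leftCoef, rightCoef, one_ne_zero, true_and, if_false, if_true, ← hn3,
        hu, hv, Nat.cast_ofNat] at q1 hle hneg ⊢
      linarith
    · have hlast := last_step_ge_of_almost_convex hδ hf (by omega) (by
        rw [hfN, hf0, hclamp' hneg.le, ← hsv, abs_of_neg hneg]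
        have := min_le_left (-(s * v)) (windowWidth n 0)
        linarith)
      have hfl : f (n - 2 - 1) = s * (t (n - 1) - ((n : ℝ) - 1) / n) := by
        simp only [f, if_neg (show ¬ n - 2 - 1 = 0 by omega), show n - 2 - 1 + 2 = n - 1 by omega]
        push_cast [show 1 ≤ n by omega]
        ring
      rw [hfN, hfl, hN] at hlast
      rw [show nextPiece n 1 = n - 1 by simp [nextPiece], hone 1 (by omega), htwo 1 (by omega),
        show n - 1 + 1 = n by omega, hoth 1 n le_rfl (by omega) (by omega),
        hoth 1 (n - 1) (by omega) (by omega) (by omega), htn] at q1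
      have hdiv : ((n : ℝ) - 1) / n = 1 - 1 / n := by field_simp
      have htwo' : (2 : ℝ) / n = 1 / n + 1 / n := by ring
      rw [hdiv] at hlast
      simp only [leftCoef, rightCoef, one_ne_zero, true_and, if_false, if_true,
        show ¬ n = 3 by omega, hu, hv, htwo'] at q1 ⊢
      linarith
  · rw [show nextPiece n 2 = 0 by simp [nextPiece], hone 2 (by omega), htwo 2 (by omega),
      hoth 2 3 (by omega) (by omega) (by omega), hoth 2 0 (by omega) (by omega) (by omega),
      ht0] at q2
    refine q2.trans (le_of_eq ?_)
    simp only [leftCoef, rightCoef, OfNat.ofNat_ne_zero, OfNat.ofNat_ne_one, false_and, if_false,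
      hu, hv]
    ring
  · intro hpos
    -- Almost convexity makes the third cut's displacement at most the truncated one of the second,
    -- up to `(n - 2) * δ`; the truncation supplies the gain `7/8 * w`.
    have hfirst := first_step_le_of_almost_convex hδ hf (by omega) (by
        rw [hfN, hf0, hclamp hpos.le, ← hsv, abs_of_pos hpos]
        have := min_le_left (s * v) (windowWidth n 0)
        linarith)
    have hf1 : f 1 = s * (t 3 - 3 / n) := by
      simp only [f, if_neg one_ne_zero]
      norm_num
    have hmin : windowWidth n M ≤ min |v| (windowWidth n 0) := le_min h2.2 hwM0
    rw [hf1, hf0, hclamp hpos.le, hN] at hfirst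
    have := (abs_le.1 (hY' 2)).1
    linarith

end

/-! ### Envy of every allocation cut outside the windows -/

/-- A sequence from `0` to `n` whose `n` steps are all almost at least one stays close to the
identity. -/
theorem abs_sub_le_of_step_ge {f : ℕ → ℝ} {n : ℕ} {η : ℝ} (hη : 0 ≤ η) (h0 : f 0 = 0)
    (hn : f n = n) (hf : ∀ k < n, 1 - η ≤ f (k + 1) - f k) {k : ℕ} (hk : k ≤ n) :
    |f k - k| ≤ n * η := by
  have key : ∀ a b, a ≤ b → b ≤ n → ((b : ℝ) - a) * (1 - η) ≤ f b - f a := by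
    intro a b hab
    induction b, hab using Nat.le_induction with
    | base => intro _; simp
    | succ b hab ih =>
      intro hb
      have h1 := ih (by omega)
      have h2 := hf b (by omega)
      push_cast
      linarith
  have h1 := key 0 k (Nat.zero_le k) hk
  have h2 := key k n hk le_rfl
  have h3 : (k : ℝ) ≤ n := by exact_mod_cast hk
  have h4 : (0 : ℝ) ≤ k := Nat.cast_nonneg k
  rw [h0] at h1
  rw [hn] at h2
  push_cast at h1
  have h5 := mul_nonneg h4 hη
  have h6 := mul_nonneg (sub_nonneg.2 h3) hη
  exact abs_le.2 ⟨by linarith, by linarith⟩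

section

variable {n : ℕ} (hn : 3 ≤ n)
include hn

theorem nextPiece_ne (i : ℕ) : nextPiece n i ≠ i := by
  unfold nextPiece
  split_ifs <;> omega

theorem liking_mul_sq : liking n * (n : ℝ) ^ 2 = 1 / 32 := by
  have : (0 : ℝ) < n := by linarith [three_le_cast hn]
  rw [liking]
  field_simp

theorem windowWidth_mul_cube : windowWidth n 0 * (n : ℝ) ^ 3 = 1 / 6400 := by
  have : (0 : ℝ) < n := by linarith [three_le_cast hn]
  rw [windowWidth]
  field_simp

omit hn in
theorem playerCDF_piece (M : ℕ) (e : ℕ → ℝ) (i : ℕ) {k : ℕ} {x y : ℝ} (hx : |n * x - k| ≤ 1 / 4)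
    (hy : |n * y - (k + 1 : ℕ)| ≤ 1 / 4) :
    playerCDF n M e i y - playerCDF n M e i x =
      (1 - liking n) * (baseCDF n M e i y - baseCDF n M e i x) +
      liking n / 2 * ((if k = i then 1 else 0) + if k = nextPiece n i then 1 else 0) := by
  have aux : ∀ j : ℕ, (if j < k + 1 then (1 : ℝ) else 0) - (if j < k then 1 else 0) =
      if k = j then 1 else 0 := by
    intro j
    split_ifs <;> first | omega | norm_num
  rw [playerCDF_zone M e i hx, playerCDF_zone M e i hy, ← aux, ← aux]
  ring

/-- In an approximately envy-free division, everybody has one of the two pieces they like. -/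
theorem perm_liked {E : ℕ → ℕ → ℝ} (hE : ∀ i k, |E i k| ≤ 1) (M : ℕ) {t : ℕ → ℝ}
    (hz : ∀ k ≤ n, |n * t k - k| ≤ 1 / 4) {ε : ℝ}
    (hεw : 100 * (n : ℝ) ^ 2 * ε ≤ windowWidth n 0) (π : Equiv.Perm (Fin n))
    (hef : ∀ i k : Fin n,
      playerCDF n M (E i) i (t (k + 1)) - playerCDF n M (E i) i (t k) - ε ≤
        playerCDF n M (E i) i (t (π i + 1)) - playerCDF n M (E i) i (t (π i))) (i : Fin n) :
    (π i : ℕ) = i ∨ (π i : ℕ) = nextPiece n i := by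
  by_contra hno
  rw [not_or] at hno
  have h3 := three_le_cast hn
  have hw := windowWidth_pos hn 0
  have hl := liking_pos hn
  have hl' := liking_le hn
  let like : Fin n → Fin n → ℝ := fun j k =>
    (if (k : ℕ) = j then 1 else 0) + if (k : ℕ) = nextPiece n j then 1 else 0
  have hpiece : ∀ j k : Fin n,
      |playerCDF n M (E j) j (t (k + 1)) - playerCDF n M (E j) j (t k) -
        ((1 - liking n) * (t (k + 1) - t k) + liking n / 2 * like j k)| ≤
        8 * windowWidth n 0 := by
    intro j k
    rw [playerCDF_piece M (E j) j (hz k k.2.le) (hz (k + 1) k.2), add_sub_add_right_eq_sub,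
      ← mul_sub, abs_mul, abs_of_pos (by linarith : 0 < 1 - liking n)]
    refine (mul_le_of_le_one_left (abs_nonneg _) (by linarith)).trans ?_
    have h1 := abs_le.1 (abs_baseCDF_sub_self_le hn (hE j) M j (t (k + 1)))
    have h2 := abs_le.1 (abs_baseCDF_sub_self_le hn (hE j) M j (t k))
    exact abs_le.2 ⟨by linarith, by linarith⟩
  have hterm : ∀ j : Fin n, (1 - liking n) * ((t (j + 1) - t j) - (t (π j + 1) - t (π j))) ≤
      16 * windowWidth n 0 + ε - liking n / 2 * (if j = i then 1 else 0) := by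
    intro j
    have h1 := (abs_le.1 (hpiece j j)).1
    have h2 := (abs_le.1 (hpiece j (π j))).2
    have h4 := hef j j
    have h5 : like j j = 1 := by
      simp only [like, if_true, if_neg (nextPiece_ne hn j).symm, add_zero]
    have h6 : like j (π j) ≤ 1 - (if j = i then 1 else 0) := by
      simp only [like]
      by_cases hji : j = i
      · subst hji
        simp [hno.1, hno.2]
      · rw [if_neg hji]
        have := nextPiece_ne hn j
        split_ifs with h7 h8
        · exact absurd (h8.symm.trans h7) this
        all_goals norm_num
    have h7 := mul_le_mul_of_nonneg_left h6 (by linarith : 0 ≤ liking n / 2)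
    rw [h5] at h1
    linarith
  -- Summed over the players, the length differences cancel because `π` is a permutation. The lost
  -- bonus `liking n / 2 = 1 / (64 n²)` of player `i` exceeds the total error `n * (16 * windowWidth
  -- n 0 + ε)`.
  have hsum := Finset.sum_le_sum fun j (_ : j ∈ Finset.univ) => hterm j
  rw [← Finset.mul_sum, Finset.sum_sub_distrib,
    Equiv.sum_comp π (fun j : Fin n => t (j + 1) - t j), sub_self, mul_zero,
    Finset.sum_sub_distrib, ← Finset.mul_sum, Finset.sum_ite_eq' Finset.univ i,
    if_pos (Finset.mem_univ i), Finset.sum_const, Finset.card_univ, Fintype.card_fin,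
    nsmul_eq_mul] at hsum
  have h1 := liking_mul_sq hn
  have h2 := windowWidth_mul_cube hn
  have h4 := windowWidth_mul_le hn
  have h5 : (n : ℝ) * (100 * (n : ℝ) ^ 2 * ε) ≤ n * windowWidth n 0 := by gcongr
  have h6 := mul_le_mul_of_nonneg_right hsum (by positivity : (0 : ℝ) ≤ (n : ℝ) ^ 2)
  linarith

/-- No connected allocation that is demarcated by points outside the windows is approximately
envy-free. -/
theorem not_isEnvyFreeUpTo {M : ℕ} (e : Fin n → ℕ → Bool) {ε : ℝ} (hε : 0 < ε)
    (hεw : 100 * (n : ℝ) ^ 2 * ε ≤ windowWidth n M) {A : Fin n → Set ℝ}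
    (hA : IsConnectedAllocation A) (hf : ∀ i, frontier (A i) ⊆ outsideWindows n M) :
    ¬ IsEnvyFreeUpTo (fun i => playerValuation hn M (e i) i) ε A := by
  intro hef
  have h3 := three_le_cast hn
  have hn0 : (0 : ℝ) < n := by linarith
  have hw := windowWidth_pos hn 0
  have hwM := windowWidth_anti hn (Nat.zero_le M)
  have hwn := windowWidth_mul_le hn
  have hl := liking_pos hn
  have hl' := liking_le hn
  have hεn : 100 * (n * ε) ≤ windowWidth n M := by
    refine le_trans ?_ hεw
    have : (n : ℝ) * ε ≤ n * (n * ε) := le_mul_of_one_le_left (by positivity) (by linarith)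
    linarith
  have hεn' : ε ≤ n * ε := le_mul_of_one_le_left hε.le (by linarith)
  have hw1 : windowWidth n 0 < 1 := by nlinarith
  -- Averaging the envy conditions over all pieces gives every player almost `1/n`.
  have havg : ∀ i, 1 - n * ε ≤ n * (playerValuation hn M (e i) i).value (A i) := by
    intro i
    have h1 := Finset.sum_le_sum fun j (_ : j ∈ Finset.univ) => hef i j
    rw [Finset.sum_sub_distrib, hA.sum_value] at h1
    simpa using h1
  have hne : ∀ i, (A i).Nonempty := by
    intro i
    rw [nonempty_iff_ne_empty]
    intro he
    have := havg i
    rw [he, CakeValuation.value_empty] at this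
    linarith
  obtain ⟨ρ, t, ht0, htn, htI, htf, htv⟩ := hA.exists_cuts (by omega) hne
  let E : ℕ → ℕ → ℝ := fun i => if h : i < n then signs (e ⟨i, h⟩) else signs fun _ => true
  have hEi : ∀ i : Fin n, E i = signs (e i) := fun i => by simp [E]
  have hE : ∀ i k, |E i k| ≤ 1 := by
    intro i k
    by_cases h : i < n
    · simpa only [E, dif_pos h] using abs_signs_le _ k
    · simpa only [E, dif_neg h] using abs_signs_le _ k
  have hval : ∀ i k : Fin n, (playerValuation hn M (e i) i).value (A (ρ k)) =
      playerCDF n M (E i) i (t (k + 1)) - playerCDF n M (E i) i (t k) := by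
    intro i k
    rw [htv, playerValuation_value hn M _ i (htI _).1, playerValuation_value hn M _ i (htI _).1, hEi]
  have hz : ∀ k ≤ n, |n * t k - k| ≤ 1 / 4 := by
    intro k hk
    have hstep : ∀ k < n, 1 - n * (ε + 2 * (4 * windowWidth n 0 + liking n)) ≤
        n * t (k + 1) - n * t k := by
      intro k hk
      have h1 := havg (ρ ⟨k, hk⟩)
      rw [hval] at h1
      have h2 := abs_le.1 (abs_playerCDF_sub_self_le hn (hE (ρ ⟨k, hk⟩)) M (ρ ⟨k, hk⟩)
        (htI (k + 1)))
      have h4 := abs_le.1 (abs_playerCDF_sub_self_le hn (hE (ρ ⟨k, hk⟩)) M (ρ ⟨k, hk⟩) (htI k))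
      have h5 : (n : ℝ) * (playerCDF n M (E (ρ ⟨k, hk⟩)) (ρ ⟨k, hk⟩) (t (k + 1)) -
          playerCDF n M (E (ρ ⟨k, hk⟩)) (ρ ⟨k, hk⟩) (t k)) ≤
          n * (t (k + 1) - t k + 2 * (4 * windowWidth n 0 + liking n)) :=
        mul_le_mul_of_nonneg_left (by linarith) hn0.le
      linarith
    refine (abs_sub_le_of_step_ge (f := fun k => n * t k) (by positivity) (by simp [ht0])
      (by simp [htn]) hstep hk).trans ?_
    have h1 := liking_mul_sq hn
    have h2 := windowWidth_mul_cube hn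
    have h4 : windowWidth n 0 * (n : ℝ) ^ 2 ≤ windowWidth n 0 * (n : ℝ) ^ 3 := by
      gcongr
      · linarith
      · norm_num
    linarith
  have hef' : ∀ i k : Fin n,
      playerCDF n M (E i) i (t (k + 1)) - playerCDF n M (E i) i (t k) - ε ≤
        playerCDF n M (E i) i (t (ρ.symm i + 1)) - playerCDF n M (E i) i (t (ρ.symm i)) := by
    intro i k
    rw [← hval, ← hval, ρ.apply_symm_apply]
    exact hef i (ρ k)
  have hperm := perm_eq_or_eq_nextPiece hn ρ.symm
    (perm_liked hn hE M hz (hεw.trans hwM) ρ.symm hef')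
  have hδw : 6 * ((n : ℝ) + 2) * (2 * ε) < windowWidth n M := by nlinarith
  have hlast : ∀ i k : ℕ, i < n → k < n → k = i ∨ k = nextPiece n i →
      playerCDF n M (E i) i (t (k + 1)) - playerCDF n M (E i) i (t k) =
      (1 - liking n) * (baseCDF n M (E i) i (t (k + 1)) - baseCDF n M (E i) i (t k)) +
        liking n / 2 := by
    intro i k hi hk hik
    rw [playerCDF_piece M (E i) i (hz k hk.le) (hz (k + 1) hk)]
    have := nextPiece_ne hn i
    rcases hik with rfl | rfl
    · rw [if_pos rfl, if_neg this.symm]; ring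
    · rw [if_pos rfl, if_neg this]; ring
  -- Since `1 - liking n ≥ 1/2`, removing this factor at most doubles the error.
  have hscale : ∀ {D : ℝ}, -ε ≤ (1 - liking n) * D → -(2 * ε) ≤ D := by
    intro D hD
    by_contra hlt
    push Not at hlt
    nlinarith
  have hout : ∀ k, 1 ≤ k → k < n → t k ∈ outsideWindows n M := fun k _ hk => hf _ (htf ⟨k, hk⟩)
  -- The two assignments reverse all comparisons of liked pieces, which is the sign `s`.
  rcases hperm with hπ | hπ
  · refine cuts_contradiction hn hE M ht0 htn hz (hout 1 le_rfl (by omega))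
      (hout 2 (by omega) (by omega)) (by positivity : 0 ≤ 2 * ε) hδw (s := 1) (by simp) ?_
    intro i hi
    have h1 := hef' ⟨i, hi⟩ ⟨nextPiece n i, nextPiece_lt hn hi⟩
    rw [hπ] at h1
    simp only at h1
    rw [hlast i i hi hi (.inl rfl), hlast i _ hi (nextPiece_lt hn hi) (.inr rfl)] at h1
    rw [one_mul]
    exact hscale (by linarith)
  · refine cuts_contradiction hn hE M ht0 htn hz (hout 1 le_rfl (by omega))
      (hout 2 (by omega) (by omega)) (by positivity : 0 ≤ 2 * ε) hδw (s := -1) (by simp) ?_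
    intro i hi
    have h1 := hef' ⟨i, hi⟩ ⟨i, hi⟩
    rw [hπ] at h1
    simp only at h1
    rw [hlast i i hi hi (.inl rfl), hlast i _ hi (nextPiece_lt hn hi) (.inr rfl)] at h1
    exact hscale (by linarith)

end

/-! ### The adversary's strategy and the final count -/

theorem zero_one_subset_outsideWindows {n : ℕ} (hn : 3 ≤ n) :
    ({0, 1} : Set ℝ) ⊆ outsideWindows n 0 := by
  have h3 := three_le_cast hn
  rintro y (rfl | rfl)
  · exact ⟨windowWidth_le_abs_sub hn (by norm_num), windowWidth_le_abs_sub hn (by norm_num)⟩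
  · exact ⟨windowWidth_le_abs_sub hn (le_abs.2 (.inl (by linarith))),
      windowWidth_le_abs_sub hn (le_abs.2 (.inl (by linarith)))⟩

/-- The adversary keeps all available cut points outside the windows. -/
theorem exists_reaches_outsideWindows {n : ℕ} (hn : 3 ≤ n) {M : ℕ} {ε : ℝ} (hε : 0 < ε)
    (hεw : 100 * (n : ℝ) ^ 2 * ε ≤ windowWidth n M) {P : RWProtocol n}
    (hP : P.ComputesConnectedEnvyFree ε) :
    ∀ m ≤ M, ∃ (e : Fin n → ℕ → Bool) (h : List ℝ) (C : Set ℝ), h.length = m ∧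
      C ⊆ outsideWindows n m ∧ C ⊆ Icc 0 1 ∧
      ∀ e' : Fin n → ℕ → Bool, (∀ i, ∀ k < m, e' i k = e i k) →
        P.Reaches (fun i => playerValuation hn M (e' i) i) h C := by
  classical
  intro m
  induction m with
  | zero =>
    intro _
    refine ⟨fun _ _ => true, [], {0, 1}, rfl, zero_one_subset_outsideWindows hn, ?_,
      fun _ _ => .start⟩
    rintro y (rfl | rfl) <;> norm_num
  | succ m ih =>
    intro hm
    obtain ⟨e, h, C, hl, hC, hCI, hr⟩ := ih (by omega)
    obtain ⟨q, A, ho, hA, hef⟩ := hP fun i => playerValuation hn M (e i) i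
    have hre := hr e fun _ _ _ => rfl
    have hCm := hC.trans (outsideWindows_mono hn (Nat.le_succ m))
    cases hmove : P h with
    | output A' =>
      refine absurd hef (not_isEnvyFreeUpTo hn e hε hεw hA fun i => ?_)
      exact ((hre.eq_of_outputs hmove ho).2 i).trans (hC.trans (outsideWindows_mono hn (by omega)))
    | eval i y =>
      have hy := hre.eval_mem_of_outputs hmove ho
      refine ⟨e, h ++ [(playerValuation hn M (e i) i).value (Icc 0 y)], C, by simp [hl], hCm, hCI,
        fun e' he' => ?_⟩
      have he : ∀ i, ∀ k < m, e' i k = e i k := fun i k hk => he' i k (by omega)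
      have hval : (playerValuation hn M (e i) i).value (Icc 0 y) =
          (playerValuation hn M (e' i) i).value (Icc 0 y) := by
        rw [playerValuation_value hn M _ i (hCI hy).1, playerValuation_value hn M _ i (hCI hy).1]
        exact playerCDF_congr hn M (fun k hk => by simp only [signs, he i k hk]) i (hC hy)
      rw [hval]
      exact .eval (hr e' he) hmove hy
    | cut i α =>
      obtain ⟨b, hb⟩ := exists_sign hn i (by omega : m < M) (e i) α
      -- Only the queried player's sign of level `m` matters here; the other players' signs of this
      -- level are frozen at their old values.
      set e₁ := Function.update e i (Function.update (e i) m b) with he₁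
      have hsame : ∀ j, ∀ k < m, e₁ j k = e j k := by
        intro j k hk
        by_cases hj : j = i
        · subst hj
          rw [he₁, Function.update_self, Function.update_of_ne hk.ne]
        · rw [he₁, Function.update_of_ne hj]
      have hbit : e₁ i m = b := by rw [he₁, Function.update_self, Function.update_self]
      have hout := hb (e₁ i) (hsame i) hbit
      refine ⟨e₁, h ++ [(playerValuation hn M (e₁ i) i).cutPoint α],
        insert ((playerValuation hn M (e₁ i) i).cutPoint α) C, by simp [hl],
        insert_subset hout hCm,
        insert_subset ((playerValuation hn M (e₁ i) i).isLeast_cutPoint α).1.1 hCI,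
        fun e' he' => ?_⟩
      have he : ∀ j, ∀ k < m, e' j k = e j k := fun j k hk =>
        (he' j k (by omega)).trans (hsame j k hk)
      have hout' := hb (e' i) (he i) ((he' i m (Nat.lt_succ_self m)).trans hbit)
      rw [cutPoint_congr hn i M (fun k hk => (he' i k hk).symm) α hout hout']
      exact .cut (hr e' he) hmove

/-- A small error requires many queries. -/
theorem RWProtocol.ComputesConnectedEnvyFree.exists_level_le_outputs {n : ℕ} (hn : 3 ≤ n) {M : ℕ}
    {ε : ℝ} (hε : 0 < ε) (hεw : 100 * (n : ℝ) ^ 2 * ε ≤ windowWidth n M) {P : RWProtocol n}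
    (hP : P.ComputesConnectedEnvyFree ε) : ∃ V q A, P.Outputs V q A ∧ M ≤ q := by
  obtain ⟨e, h, C, hl, -, -, hr⟩ := exists_reaches_outsideWindows hn hε hεw hP M le_rfl
  obtain ⟨q, A, ho, -⟩ := hP fun i => playerValuation hn M (e i) i
  exact ⟨_, q, A, ho, hl ▸ (hr e fun _ _ _ => rfl).length_le_of_outputs ho⟩

/-- The window of level about `log (1/ε) / 20` is still large if there are few players. -/
theorem error_le_windowWidth {n M : ℕ} (hn : 3 ≤ n) {L : ℝ} (hL : 50 ≤ L) (hnL : n ≤ L / 20)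
    (hM : M ≤ L / 20 + 1) : 100 * (n : ℝ) ^ 2 * Real.exp (-L) ≤ windowWidth n M := by
  have h0 : (0 : ℝ) < n := by linarith [three_le_cast hn]
  have two_le : (2 : ℝ) ≤ Real.exp 1 := by linarith [Real.add_one_le_exp 1]
  have h1 : (640000 : ℝ) ≤ Real.exp 20 := by
    calc (640000 : ℝ) ≤ 2 ^ 20 := by norm_num
      _ ≤ Real.exp 1 ^ 20 := by gcongr
      _ = Real.exp 20 := by rw [← Real.exp_nat_mul]; norm_num
  have h2 : (17 : ℝ) ^ M ≤ Real.exp (5 * M) := by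
    calc (17 : ℝ) ^ M ≤ (2 ^ 5) ^ M := by gcongr; norm_num
      _ ≤ (Real.exp 1 ^ 5) ^ M := by gcongr
      _ = Real.exp (5 * M) := by
        rw [← pow_mul, ← Real.exp_nat_mul]; push_cast; ring_nf
  have h3 : (n : ℝ) ^ 5 ≤ Real.exp (5 * n) := by
    calc (n : ℝ) ^ 5 ≤ Real.exp n ^ 5 := by gcongr; linarith [Real.add_one_le_exp (n : ℝ)]
      _ = Real.exp (5 * n) := by rw [← Real.exp_nat_mul]; norm_num
  rw [windowWidth, le_div_iff₀ (by positivity)]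
  calc 100 * (n : ℝ) ^ 2 * Real.exp (-L) * (6400 * (n : ℝ) ^ 3 * 17 ^ M)
      = 640000 * (n : ℝ) ^ 5 * 17 ^ M * Real.exp (-L) := by ring
    _ ≤ Real.exp 20 * Real.exp (5 * n) * Real.exp (5 * M) * Real.exp (-L) := by gcongr
    _ = Real.exp (20 + 5 * n + 5 * M + -L) := by rw [Real.exp_add, Real.exp_add, Real.exp_add]
    -- The exponent is at most `20 + L/4 + (L/4 + 5) - L = 25 - L/2`, which is where `L ≥ 50` is
    -- needed.
    _ ≤ 1 := Real.exp_le_one_iff.2 (by linarith)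

end

theorem mainTheorem6 :
    ∃ c : ℝ, 0 < c ∧ ∃ ε₀ : ℝ, 0 < ε₀ ∧
      ∀ n : ℕ, 3 ≤ n → ∀ ε : ℝ, 0 < ε → ε < ε₀ →
        ∀ P : RWProtocol n, P.ComputesConnectedEnvyFree ε →
          ∃ (V : Fin n → CakeValuation) (q : ℕ) (A : Fin n → Set ℝ),
            P.Outputs V q A ∧ c * Real.log (1 / ε) ≤ q := by
  refine ⟨1 / 20, by norm_num, Real.exp (-50), Real.exp_pos _, fun n hn ε hε hε₀ P hP => ?_⟩
  have hL : 50 ≤ Real.log (1 / ε) := by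
    have := Real.log_lt_log hε hε₀
    rw [Real.log_exp] at this
    rw [one_div, Real.log_inv]
    linarith
  -- With few players the polynomial loss in `n` is affordable and the adversary applies; with many
  -- players, `n` queries already suffice for the bound.
  rcases le_total (n : ℝ) (Real.log (1 / ε) / 20) with hnL | hnL
  · have hM := Nat.le_ceil (Real.log (1 / ε) / 20)
    have hM' := (Nat.ceil_lt_add_one (by linarith : 0 ≤ Real.log (1 / ε) / 20)).le
    have hεL : Real.exp (-Real.log (1 / ε)) = ε := by
      rw [one_div, Real.log_inv, neg_neg, Real.exp_log hε]
    have hw := error_le_windowWidth hn hL hnL hM'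
    rw [hεL] at hw
    obtain ⟨V, q, A, ho, hq⟩ := hP.exists_level_le_outputs hn hε hw
    have hq' : ((⌈Real.log (1 / ε) / 20⌉₊ : ℕ) : ℝ) ≤ q := by exact_mod_cast hq
    exact ⟨V, q, A, ho, by linarith⟩
  · have hε1 : ε < 1 := hε₀.trans (Real.exp_lt_one_iff.2 (by norm_num))
    obtain ⟨V, q, A, ho, hq⟩ := hP.exists_le_outputs (by omega) hε1
    have hq' : (n : ℝ) ≤ q := by exact_mod_cast hq
    exact ⟨V, q, A, ho, by linarith⟩
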